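/- **Theorem.** Let $d\ge 2$, and let $\mathbf k\in L^1(\mathbb R^d,\mathbb R^{d\times d})$ have the form $$\mathbf k(x)=k^\parallel(\|x\|)\,\mathrm{Pr}^\parallel_x+k^\perp(\|x\|)\,\mathrm{Pr}^\perp_x,\qquad x\neq 0,$$ where $k^\parallel,k^\perp:(0,\infty)\to\mathbb R$, $\mathrm{Pr}^\parallel_x=xx^T/\|x\|^2$ and $\mathrm{Pr}^\perp_x=I_d-xx^T/\|x\|^2$. Put $\mu=\frac d2-1$, let $J_\nu$ be the Bessel function of the first kind of order $\nu$, and let $\widehat{\mathbf k}(\xi)=\int_{\mathbb R^d}\mathbf k(x)e^{-2\pi i x\cdot\xi}\,dx$ be the entrywise Fourier transform. Then for every $\xi\ne 0$ $$\widehat{\mathbf k}(\xi)=h^\parallel(\|\xi\|)\,\mathrm{Pr}^\parallel_\xi+h^\perp(\|\xi\|)\,\mathrm{Pr}^\perp_\xi ,$$ where, for $\varrho>0$, $$h^\parallel(\varrho)=\frac{2\pi}{\varrho^\mu}\int_0^\infty r^{\mu+1}k^\parallel(r)J_\mu(2\pi\varrho r)\,dr-\frac{2\mu+1}{\varrho^{\mu+1}}\int_0^\infty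 r^\mu\bigl(k^\parallel(r)-k^\perp(r)\bigr)J_{\mu+1}(2\pi\varrho r)\,dr,$$ $$h^\perp(\varrho)=\frac{2\pi}{\varrho^\mu}\int_0^\infty r^{\mu+1}k^\perp(r)J_\mu(2\pi\varrho r)\,dr+\frac{1}{\varrho^{\mu+1}}\int_0^\infty r^\mu\bigl(k^\parallel(r)-k^\perp(r)\bigr)J_{\mu+1}(2\pi\varrho r)\,dr,$$ all these integrals being absolutely convergent. Call $\mathbf k$ *positive definite* if $\sum_{a,b=1}^N\alpha_a\cdot\mathbf k(x_a-x_b)\alpha_b\ge 0$ for all $N$, $x_1,\dots,x_N\in\mathbb R^d$ and $\alpha_1,\dots,\alpha_N\in\mathbb R^d$, and a *kernel* if moreover $\mathbf k(-x)=\mathbf k(x)^T$ for all $x$. If $\mathbf k$ is positive definite, then $h^\parallel\ge 0$ and $h^\perp\ge 0$ on $(0,\infty)$. If $\mathbf k$ is continuous, then $\mathbf k$ is a kernel if and only if $h^\parallel\ge 0$ and $h^\perp\ge 0$ on $(0,\infty)$. If $\widehat{\mathbf k}\in L^1$, then $\mathbf k$ agrees almost everywhere with a continuous function, and that function is a kernel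 if and only if $h^\parallel\ge 0$ and $h^\perp\ge 0$ on $(0,\infty)$. -/

import Mathlib

open MeasureTheory
open scoped FourierTransform

noncomputable section

/-- The projection `x xᵀ / ‖x‖²` onto the line spanned by `x`. Used only for `x ≠ 0`. -/
def prPar {d : ℕ} (x : EuclideanSpace ℝ (Fin d)) : Matrix (Fin d) (Fin d) ℝ :=
  (‖x‖ ^ 2)⁻¹ • Matrix.vecMulVec (fun i => x i) (fun i => x i)

/-- The projection `I - x xᵀ / ‖x‖²` onto the hyperplane orthogonal to `x`.
Used only for `x ≠ 0`. -/
def prPerp {d : ℕ} (x : EuclideanSpace ℝ (Fin d)) : Matrix (Fin d) (Fin d) ℝ :=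
  1 - prPar x

/-- The matrix function `k` has the coefficients `kpar`, `kperp`: for all `x ≠ 0`,
`k x = kpar ‖x‖ Pr_x^∥ + kperp ‖x‖ Pr_x^⊥`. Only values at positive radii matter. -/
def HasCoefficients {d : ℕ} (k : EuclideanSpace ℝ (Fin d) → Matrix (Fin d) (Fin d) ℝ)
    (kpar kperp : ℝ → ℝ) : Prop :=
  ∀ x : EuclideanSpace ℝ (Fin d), x ≠ 0 → k x = kpar ‖x‖ • prPar x + kperp ‖x‖ • prPerp x

/-- The entrywise Fourier transform `∫ k(x) exp(-2πi x·ξ) dx` of a real matrix function. -/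
def matrixFourier {d : ℕ} (k : EuclideanSpace ℝ (Fin d) → Matrix (Fin d) (Fin d) ℝ)
    (ξ : EuclideanSpace ℝ (Fin d)) : Matrix (Fin d) (Fin d) ℂ :=
  Matrix.of fun i j => 𝓕 (fun x : EuclideanSpace ℝ (Fin d) => ((k x i j : ℝ) : ℂ)) ξ

/-- The Bessel function of the first kind of order `ν`, for real `z ≥ 0`, by its power series
`(z/2)^ν ∑ₘ (-1)^m / (m! Γ(ν + m + 1)) (z/2)^(2m)`. -/
def besselJ (ν z : ℝ) : ℝ :=
  (z / 2) ^ ν *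
    ∑' m : ℕ, (-1) ^ m / ((m.factorial : ℝ) * Real.Gamma (ν + m + 1)) * (z / 2) ^ (2 * m)

/-- The order `μ = d/2 - 1`. -/
def besselOrder (d : ℕ) : ℝ := (d : ℝ) / 2 - 1

/-- The integrand `r^(μ+1) f(r) J_μ(2πϱr)`. -/
def hankelIntegrand (d : ℕ) (f : ℝ → ℝ) (ϱ r : ℝ) : ℝ :=
  r ^ (besselOrder d + 1) * f r * besselJ (besselOrder d) (2 * Real.pi * ϱ * r)

/-- The integrand `r^μ f(r) J_{μ+1}(2πϱr)`. -/
def hankelIntegrandSucc (d : ℕ) (f : ℝ → ℝ) (ϱ r : ℝ) : ℝ :=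
  r ^ besselOrder d * f r * besselJ (besselOrder d + 1) (2 * Real.pi * ϱ * r)

/-- The coefficient `h^∥` of the Fourier transform:
`2π/ϱ^μ ∫₀^∞ r^(μ+1) k^∥ J_μ(2πϱr) dr - (2μ+1)/ϱ^(μ+1) ∫₀^∞ r^μ (k^∥ - k^⊥) J_{μ+1}(2πϱr) dr`. -/
def hPar (d : ℕ) (kpar kperp : ℝ → ℝ) (ϱ : ℝ) : ℝ :=
  2 * Real.pi / ϱ ^ besselOrder d * (∫ r in Set.Ioi (0 : ℝ), hankelIntegrand d kpar ϱ r)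
    - (2 * besselOrder d + 1) / ϱ ^ (besselOrder d + 1) *
      (∫ r in Set.Ioi (0 : ℝ), hankelIntegrandSucc d (fun s => kpar s - kperp s) ϱ r)

/-- The coefficient `h^⊥` of the Fourier transform:
`2π/ϱ^μ ∫₀^∞ r^(μ+1) k^⊥ J_μ(2πϱr) dr + 1/ϱ^(μ+1) ∫₀^∞ r^μ (k^∥ - k^⊥) J_{μ+1}(2πϱr) dr`. -/
def hPerp (d : ℕ) (kpar kperp : ℝ → ℝ) (ϱ : ℝ) : ℝ :=
  2 * Real.pi / ϱ ^ besselOrder d * (∫ r in Set.Ioi (0 : ℝ), hankelIntegrand d kperp ϱ r)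
    + 1 / ϱ ^ (besselOrder d + 1) *
      (∫ r in Set.Ioi (0 : ℝ), hankelIntegrandSucc d (fun s => kpar s - kperp s) ϱ r)

/-- Positive definiteness of a matrix-valued function of two variables:
`∑_{a,b} α_a · K(x_a, x_b) α_b ≥ 0` for all finite families of points and vectors. -/
def IsPosDefFunction {Ω : Type*} {d : ℕ} (K : Ω → Ω → Matrix (Fin d) (Fin d) ℝ) : Prop :=
  ∀ (N : ℕ) (x : Fin N → Ω) (α : Fin N → Fin d → ℝ),
    0 ≤ ∑ a, ∑ b, α a ⬝ᵥ (K (x a) (x b)).mulVec (α b)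

/-- A (positive) kernel: a positive definite function with `K(y, x) = K(x, y)ᵀ`. -/
def IsPositiveKernel {Ω : Type*} {d : ℕ} (K : Ω → Ω → Matrix (Fin d) (Fin d) ℝ) : Prop :=
  IsPosDefFunction K ∧ ∀ x y, K y x = (K x y).transpose

end

/-! ### Polar coordinates for a Haar measure. -/

section Polar

open Set Metric Measure

variable {E : Type*} [NormedAddCommGroup E] [NormedSpace ℝ E] [MeasurableSpace E] [BorelSpace E]
  [FiniteDimensional ℝ E]

/-! Since `k` is even, its Fourier transform is a cosine transform. Write `k = kperp I + (kpar -
kperp) x xᵀ/‖x‖²` and evaluate at `ξ = ϱ u` with `u` a unit vector. The first summand contributes a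
scalar matrix. The second gives a symmetric bilinear form invariant under every isometry fixing `u`,
so its value at `(u, u)` and its trace determine it (`form_eq_of_invariant`, `radialForm_eq`). Polar
coordinates reduce both numbers to the sphere integrals `sphereCos 0` and `sphereCos 1`. Expanding
the cosine and inserting the even moments of the sphere, which come from Gaussian integrals, turns
these into the Bessel functions of orders `μ` and `μ + 1` (`two_pi_mul_besselJ`, `besselJ_succ`).

Necessity of the signs is a sampling argument. For independent points with a common law, the
expected double sum is dominated for large `N` by the off-diagonal pairs, so their mean is
nonnegative (`integral_prod_nonneg_of_sum_nonneg`). Gaussian laws that spread out then give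
nonnegative diagonal entries of the transform, without continuity of `k`. At a frequency on a
coordinate axis these entries are `hPar` and `hPerp`.

Conversely, nonnegative coefficients make the transform positive semidefinite away from 0. Gaussian
summation recovers a continuous `k` pointwise as a limit of positive definite functions, even if the
transform is not integrable. If it is integrable, almost everywhere inversion supplies the
continuous version, which has the same transform. -/

theorem integrable_polar (μ : Measure E) [μ.IsAddHaarMeasure] {F : E → ℝ} (hF : Integrable F μ) :
    Integrable (fun p : sphere (0 : E) 1 × Ioi (0 : ℝ) => F (p.2.1 • p.1.1))
      (μ.toSphere.prod (volumeIoiPow (Module.finrank ℝ E - 1))) := by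
  rw [← μ.measurePreserving_homeomorphUnitSphereProd.integrable_comp_emb
    (Homeomorph.measurableEmbedding _)]
  have h1 : IntegrableOn F ({0}ᶜ : Set E) μ := hF.integrableOn
  rw [integrableOn_iff_comap_subtypeVal (by measurability)] at h1
  refine h1.congr (.of_forall fun x => ?_)
  have hx : (x : E) ≠ 0 := x.2
  have hx' : ‖(x : E)‖ ≠ 0 := norm_ne_zero_iff.2 hx
  simp [smul_smul, hx']

theorem integral_polar_prod [Nontrivial E] (μ : Measure E) [μ.IsAddHaarMeasure] (F : E → ℝ) :
    ∫ x, F x ∂μ = ∫ p : sphere (0 : E) 1 × Ioi (0 : ℝ), F (p.2.1 • p.1.1)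
      ∂(μ.toSphere.prod (volumeIoiPow (Module.finrank ℝ E - 1))) := by
  rw [← μ.measurePreserving_homeomorphUnitSphereProd.integral_comp
    (Homeomorph.measurableEmbedding _)]
  calc ∫ x, F x ∂μ = ∫ x in ({0}ᶜ : Set E), F x ∂μ := by rw [restrict_compl_singleton]
    _ = ∫ x : ({0}ᶜ : Set E), F x ∂(μ.comap (↑)) :=
        (integral_subtype_comap (measurableSet_singleton _).compl F).symm
    _ = _ := by
        refine integral_congr_ae (.of_forall fun x => ?_)
        have hx : (x : E) ≠ 0 := x.2
        have hx' : ‖(x : E)‖ ≠ 0 := norm_ne_zero_iff.2 hx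
        simp [smul_smul, hx']

theorem integral_volumeIoiPow (n : ℕ) (g : ℝ → ℝ) :
    ∫ r : Ioi (0 : ℝ), g r ∂(volumeIoiPow n) = ∫ r in Ioi (0 : ℝ), r ^ n * g r := by
  rw [volumeIoiPow, integral_withDensity_eq_integral_toReal_smul (by fun_prop) (by simp),
    ← integral_subtype_comap measurableSet_Ioi]
  refine integral_congr_ae (.of_forall fun r => ?_)
  have hr : (0 : ℝ) < r := r.2
  simp [ENNReal.toReal_ofReal (pow_nonneg hr.le n)]

theorem integrable_volumeIoiPow (n : ℕ) {g : ℝ → ℝ} :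
    Integrable (fun r : Ioi (0 : ℝ) => g r) (volumeIoiPow n) ↔
      IntegrableOn (fun r => r ^ n * g r) (Ioi 0) := by
  rw [volumeIoiPow, integrable_withDensity_iff_integrable_smul' (by fun_prop) (by simp),
    integrableOn_iff_comap_subtypeVal measurableSet_Ioi]
  refine integrable_congr (.of_forall fun r => ?_)
  have hr : (0 : ℝ) < r := r.2
  simp [ENNReal.toReal_ofReal (pow_nonneg hr.le n)]

/-- Integration in polar coordinates. -/
theorem integral_polar [Nontrivial E] (μ : Measure E) [μ.IsAddHaarMeasure] {F : E → ℝ} (hF : Integrable F μ) :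
    ∫ x, F x ∂μ = ∫ r in Ioi (0 : ℝ), r ^ (Module.finrank ℝ E - 1) *
      ∫ ω : sphere (0 : E) 1, F (r • (ω : E)) ∂μ.toSphere := by
  rw [integral_polar_prod, integral_prod_symm _ (integrable_polar μ hF)]
  exact integral_volumeIoiPow _ (fun r => ∫ ω : sphere (0 : E) 1, F (r • (ω : E)) ∂μ.toSphere)

theorem integrableOn_polar (μ : Measure E) [μ.IsAddHaarMeasure] {F : E → ℝ} (hF : Integrable F μ) :
    IntegrableOn (fun r => r ^ (Module.finrank ℝ E - 1) *
      ∫ ω : sphere (0 : E) 1, F (r • (ω : E)) ∂μ.toSphere) (Ioi 0) :=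
  (integrable_volumeIoiPow _).1 (integrable_polar μ hF).integral_prod_right

end Polar

/-! ### Even moments of the sphere from Gaussian integrals. -/

section Moments

open Set Metric Measure Real

theorem gaussian_moment (m : ℕ) :
    ∫ y : ℝ, y ^ (2 * m) * exp (-y ^ 2) = Gamma (m + 1 / 2) := by
  have h := integral_comp_abs (f := fun y : ℝ => y ^ (2 * m) * exp (-y ^ 2))
  simp only [sq_abs, (even_two_mul m).pow_abs] at h
  rw [h]
  have h2 := integral_rpow_mul_exp_neg_rpow (p := 2) (q := (2 * m : ℕ)) (by norm_num)
    (by linarith [(2 * m : ℕ).cast_nonneg (α := ℝ)])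
  simp only [rpow_natCast, rpow_two] at h2
  rw [h2]
  push_cast
  rw [show ((2 * (m : ℝ) + 1) / 2) = m + 1 / 2 by ring]
  ring

theorem integrable_gaussian_moment (m : ℕ) :
    Integrable (fun y : ℝ => y ^ (2 * m) * exp (-y ^ 2)) := by
  have := integrable_rpow_mul_exp_neg_mul_sq (b := 1) one_pos (s := (2 * m : ℕ))
    (by linarith [(2 * m : ℕ).cast_nonneg (α := ℝ)])
  simpa only [rpow_natCast, neg_one_mul, neg_mul, one_mul] using this

variable {d : ℕ}

/-- The product form lets Fubini split the integral into one-dimensional Gaussian moments, of order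
`2 * m` at `i` and of order 0 elsewhere. -/
theorem coord_moment_prod (m : ℕ) (i : Fin d) (x : EuclideanSpace ℝ (Fin d)) :
    x i ^ (2 * m) * exp (-‖x‖ ^ 2) =
      ∏ j, (x j ^ (2 * if j = i then m else 0) * exp (-x j ^ 2)) := by
  rw [Finset.prod_mul_distrib, ← Real.exp_sum, EuclideanSpace.real_norm_sq_eq, Finset.sum_neg_distrib]
  congr 1
  rw [Finset.prod_eq_single i] <;> simp +contextual

theorem integrable_coord_moment (m : ℕ) (i : Fin d) :
    Integrable (fun x : EuclideanSpace ℝ (Fin d) => x i ^ (2 * m) * exp (-‖x‖ ^ 2)) := by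
  simp only [coord_moment_prod]
  rw [← (PiLp.volume_preserving_toLp (Fin d)).integrable_comp_emb
    (MeasurableEquiv.toLp 2 _).measurableEmbedding]
  exact Integrable.fintype_prod (f := fun j (y : ℝ) => y ^ (2 * if j = i then m else 0) * exp (-y ^ 2))
    fun j => integrable_gaussian_moment _

theorem integral_coord_moment (m : ℕ) (i : Fin d) :
    ∫ x : EuclideanSpace ℝ (Fin d), x i ^ (2 * m) * exp (-‖x‖ ^ 2) =
      Gamma (m + 1 / 2) * √π ^ (d - 1) := by
  simp only [coord_moment_prod]
  rw [← (PiLp.volume_preserving_toLp (Fin d)).integral_comp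
    (MeasurableEquiv.toLp 2 _).measurableEmbedding]
  have := integral_fintype_prod_volume_eq_prod
    (fun (j : Fin d) (y : ℝ) => y ^ (2 * if j = i then m else 0) * exp (-y ^ 2))
  simp only [gaussian_moment] at this
  refine this.trans ?_
  rw [← Finset.mul_prod_erase _ _ (Finset.mem_univ i), Finset.prod_congr rfl (g := fun _ => √π)]
  · simp
  · intro j hj
    rw [if_neg (Finset.ne_of_mem_erase hj), ← Real.Gamma_one_half_eq]
    simp

/-- The reflection in the hyperplane orthogonal to `v - w` exchanges `v` and `w`. -/
theorem exists_isometry_map_eq {E : Type*} [NormedAddCommGroup E] [InnerProductSpace ℝ E]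
    {v w : E} (h : ‖v‖ = ‖w‖) : ∃ R : E ≃ₗᵢ[ℝ] E, R v = w :=
  ⟨_, Submodule.reflection_sub h⟩

theorem inner_moment_comp (m : ℕ) {u : EuclideanSpace ℝ (Fin d)} (hu : ‖u‖ = 1) (i : Fin d) :
    ∃ R : EuclideanSpace ℝ (Fin d) ≃ₗᵢ[ℝ] EuclideanSpace ℝ (Fin d), ∀ x,
      inner ℝ u (R x) ^ (2 * m) * exp (-‖R x‖ ^ 2) = x i ^ (2 * m) * exp (-‖x‖ ^ 2) := by
  obtain ⟨R, hR⟩ := exists_isometry_map_eq (v := EuclideanSpace.single i (1 : ℝ)) (w := u)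
    (by simp [hu])
  refine ⟨R, fun x => ?_⟩
  rw [← hR, R.inner_map_map, R.norm_map, EuclideanSpace.inner_single_left]
  simp

theorem integral_inner_moment (m : ℕ) {u : EuclideanSpace ℝ (Fin d)} (hu : ‖u‖ = 1) (hd : 0 < d) :
    ∫ x : EuclideanSpace ℝ (Fin d), inner ℝ u x ^ (2 * m) * exp (-‖x‖ ^ 2) =
      Gamma (m + 1 / 2) * √π ^ (d - 1) := by
  obtain ⟨R, hR⟩ := inner_moment_comp m hu ⟨0, hd⟩
  rw [← R.measurePreserving.integral_comp R.toMeasurableEquiv.measurableEmbedding]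
  simp only [hR]
  exact integral_coord_moment m _

theorem integrable_inner_moment (m : ℕ) {u : EuclideanSpace ℝ (Fin d)} (hu : ‖u‖ = 1) (hd : 0 < d) :
    Integrable fun x : EuclideanSpace ℝ (Fin d) => inner ℝ u x ^ (2 * m) * exp (-‖x‖ ^ 2) := by
  obtain ⟨R, hR⟩ := inner_moment_comp m hu ⟨0, hd⟩
  rw [← R.measurePreserving.integrable_comp_emb R.toMeasurableEquiv.measurableEmbedding]
  refine (integrable_coord_moment m ⟨0, hd⟩).congr (.of_forall fun x => (hR x).symm)

/-- The even moments of a coordinate on the unit sphere. -/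
theorem sphere_moment (m : ℕ) {u : EuclideanSpace ℝ (Fin d)} (hu : ‖u‖ = 1) (hd : 0 < d) :
    Gamma (m + d / 2) * ∫ ω : sphere (0 : EuclideanSpace ℝ (Fin d)) 1,
      inner ℝ u (ω : EuclideanSpace ℝ (Fin d)) ^ (2 * m) ∂(volume : Measure _).toSphere =
      2 * Gamma (m + 1 / 2) * √π ^ (d - 1) := by
  have : Nonempty (Fin d) := ⟨⟨0, hd⟩⟩
  -- The Gaussian moment is computed a second time in polar coordinates: the radial integral is half
  -- of `Gamma (m + d / 2)`, and the sphere moment is the remaining factor.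
  have h := integral_polar volume (integrable_inner_moment m hu hd)
  rw [integral_inner_moment m hu hd] at h
  rw [mul_assoc, h]
  set M := ∫ ω : sphere (0 : EuclideanSpace ℝ (Fin d)) 1,
      inner ℝ u (ω : EuclideanSpace ℝ (Fin d)) ^ (2 * m) ∂(volume : Measure _).toSphere
  have h2 : ∀ r ∈ Ioi (0 : ℝ), r ^ (Module.finrank ℝ (EuclideanSpace ℝ (Fin d)) - 1) *
      ∫ ω : sphere (0 : EuclideanSpace ℝ (Fin d)) 1,
        (inner ℝ u (r • (ω : EuclideanSpace ℝ (Fin d))) ^ (2 * m) *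
          exp (-‖r • (ω : EuclideanSpace ℝ (Fin d))‖ ^ 2)) ∂(volume : Measure _).toSphere =
      (r ^ (((d - 1 + 2 * m : ℕ) : ℝ)) * exp (-r ^ (2 : ℝ))) * M := by
    intro r hr
    simp only [inner_smul_right, mul_pow, norm_smul, norm_eq_of_mem_sphere, mul_one,
      Real.norm_eq_abs, sq_abs, integral_mul_const, integral_const_mul, finrank_euclideanSpace_fin]
    rw [rpow_natCast, rpow_two, pow_add]
    simp only [M]
    ring
  rw [setIntegral_congr_fun measurableSet_Ioi h2, integral_mul_const,
    integral_rpow_mul_exp_neg_rpow (by norm_num) (by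
      linarith [(d - 1 + 2 * m : ℕ).cast_nonneg (α := ℝ)])]
  rw [show (((d - 1 + 2 * m : ℕ) : ℝ) + 1) / 2 = m + d / 2 by
    rw [← Nat.cast_succ, show (d - 1 + 2 * m).succ = d + 2 * m by omega]; push_cast; ring]
  ring

end Moments

/-! ### Bessel functions as cosine integrals over the sphere. -/

section BesselSphere

open Set Metric Measure Real

variable {d : ℕ}

/-- The integral `∫ ⟨u, ω⟩ ^ (2 j) cos (2π t ⟨u, ω⟩) dσ(ω)` over the unit sphere. -/
noncomputable def sphereCos (j : ℕ) (u : EuclideanSpace ℝ (Fin d)) (t : ℝ) : ℝ :=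
  ∫ ω : sphere (0 : EuclideanSpace ℝ (Fin d)) 1,
    inner ℝ u (ω : EuclideanSpace ℝ (Fin d)) ^ (2 * j) *
      cos (2 * π * t * inner ℝ u (ω : EuclideanSpace ℝ (Fin d))) ∂(volume : Measure _).toSphere

/-- The even moments of the coordinate in direction `u` on the unit sphere. -/
noncomputable def sphereMoment (m : ℕ) (u : EuclideanSpace ℝ (Fin d)) : ℝ :=
  ∫ ω : sphere (0 : EuclideanSpace ℝ (Fin d)) 1,
    inner ℝ u (ω : EuclideanSpace ℝ (Fin d)) ^ (2 * m) ∂(volume : Measure _).toSphere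

/-- The cosine series may be integrated term by term: `|⟨u, ω⟩| ≤ 1` bounds the terms by a summable
constant sequence, and the sphere has finite measure. -/
theorem hasSum_sphereCos (j : ℕ) {u : EuclideanSpace ℝ (Fin d)} (hu : ‖u‖ = 1) (t : ℝ) :
    HasSum (fun m : ℕ => (-1) ^ m * (2 * π * t) ^ (2 * m) / (2 * m).factorial *
      sphereMoment (m + j) u) (sphereCos j u t) := by
  have hle : ∀ ω : sphere (0 : EuclideanSpace ℝ (Fin d)) 1,
      |inner ℝ u (ω : EuclideanSpace ℝ (Fin d))| ≤ 1 := fun ω => by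
    simpa [hu] using abs_real_inner_le_norm u (ω : EuclideanSpace ℝ (Fin d))
  have h := hasSum_integral_of_dominated_convergence
    (μ := (volume : Measure (EuclideanSpace ℝ (Fin d))).toSphere)
    (F := fun (m : ℕ) (ω : sphere (0 : EuclideanSpace ℝ (Fin d)) 1) =>
      (-1) ^ m * (2 * π * t) ^ (2 * m) / (2 * m).factorial *
        inner ℝ u (ω : EuclideanSpace ℝ (Fin d)) ^ (2 * (m + j)))
    (f := fun ω => inner ℝ u (ω : EuclideanSpace ℝ (Fin d)) ^ (2 * j) *
      cos (2 * π * t * inner ℝ u (ω : EuclideanSpace ℝ (Fin d))))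
    (fun m _ => |2 * π * t| ^ (2 * m) / (2 * m).factorial)
    (fun m => Continuous.aestronglyMeasurable (by fun_prop))
    (fun m => .of_forall fun ω => by
      simp only [norm_mul, norm_div, norm_pow, norm_neg, norm_one, one_pow, one_mul,
        Real.norm_eq_abs, Nat.abs_cast]
      rw [abs_mul, abs_mul]
      exact mul_le_of_le_one_right (by positivity) (pow_le_one₀ (abs_nonneg _) (hle ω)))
    (.of_forall fun _ => (Real.summable_pow_div_factorial |2 * π * t|).comp_injective
      (mul_right_injective₀ two_ne_zero))
    (integrable_const _)
    (.of_forall fun ω => by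
      have h1 := (Real.hasSum_cos (2 * π * t * inner ℝ u (ω : EuclideanSpace ℝ (Fin d)))).mul_left
        (inner ℝ u (ω : EuclideanSpace ℝ (Fin d)) ^ (2 * j))
      convert! h1 using 2 with m
      ring)
  simp only [integral_const_mul] at h
  exact h

/-- Legendre's duplication formula at `m + 1 / 2`. -/
theorem Gamma_nat_add_half_mul_factorial (m : ℕ) :
    Gamma (m + 1 / 2) * m.factorial = (2 * m).factorial * √π / 2 ^ (2 * m) := by
  have h := Real.Gamma_mul_Gamma_add_half (m + 1 / 2)
  rw [show (m : ℝ) + 1 / 2 + 1 / 2 = m + 1 by ring, Real.Gamma_nat_eq_factorial,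
    show 2 * ((m : ℝ) + 1 / 2) = (2 * m : ℕ) + 1 by push_cast; ring, Real.Gamma_nat_eq_factorial,
    show 1 - (((2 * m : ℕ) : ℝ) + 1) = -(2 * m : ℕ) by push_cast; ring, rpow_neg (by norm_num),
    rpow_natCast] at h
  rw [h]
  ring

theorem sphereMoment_eq (m : ℕ) {u : EuclideanSpace ℝ (Fin d)} (hu : ‖u‖ = 1) (hd : 0 < d) :
    sphereMoment m u = 2 * √π ^ d * (2 * m).factorial /
      (2 ^ (2 * m) * (m.factorial * Gamma (m + d / 2))) := by
  have hd' : (0 : ℝ) < d := by exact_mod_cast hd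
  have hG : 0 < Gamma (m + d / 2) := Gamma_pos_of_pos (by positivity)
  have h1 := sphere_moment m hu hd
  have h2 := Gamma_nat_add_half_mul_factorial m
  have h3 : √π ^ d = √π ^ (d - 1) * √π := by rw [← pow_succ, Nat.sub_add_cancel hd]
  rw [eq_div_iff (by positivity), sphereMoment]
  rw [eq_div_iff (by positivity)] at h2
  rw [h3]
  linear_combination (2 ^ (2 * m) * (m.factorial : ℝ)) * h1 + 2 * √π ^ (d - 1) * h2

/-- Consecutive moments have ratio `(m + 1/2) / (m + d/2)`; its distance from 1 produces the factor
`d - 1`. -/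
theorem sphereMoment_succ (m : ℕ) {u : EuclideanSpace ℝ (Fin d)} (hu : ‖u‖ = 1) (hd : 0 < d) :
    sphereMoment m u - sphereMoment (m + 1) u = (d - 1) * (√π ^ d * (2 * m).factorial /
      (2 ^ (2 * m) * (m.factorial * Gamma (m + d / 2 + 1)))) := by
  have hd' : (0 : ℝ) < d := by exact_mod_cast hd
  have hG : 0 < Gamma (m + d / 2) := Gamma_pos_of_pos (by positivity)
  rw [sphereMoment_eq _ hu hd, sphereMoment_eq _ hu hd,
    show ((m + 1 : ℕ) : ℝ) + d / 2 = m + d / 2 + 1 by push_cast; ring,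
    Real.Gamma_add_one (by positivity), show 2 * (m + 1) = 2 * m + 1 + 1 by ring,
    Nat.factorial_succ, Nat.factorial_succ, Nat.factorial_succ]
  push_cast
  field_simp
  ring

theorem sqrt_pi_pow (d : ℕ) : √π ^ d = π ^ ((d : ℝ) / 2) := by
  rw [Real.sqrt_eq_rpow, ← rpow_natCast, ← rpow_mul pi_pos.le]
  ring_nf

/-- Poisson's integral for the Bessel function of order `d/2 - 1`. -/
theorem two_pi_mul_besselJ {u : EuclideanSpace ℝ (Fin d)} (hu : ‖u‖ = 1) (hd : 0 < d)
    {t : ℝ} (ht : 0 < t) :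
    2 * π * besselJ (besselOrder d) (2 * π * t) = t ^ besselOrder d * sphereCos 0 u t := by
  have h := hasSum_sphereCos 0 hu t
  rw [← h.tsum_eq, besselJ, show 2 * π * t / 2 = π * t by ring, mul_rpow pi_pos.le ht.le]
  have hπ : 2 * π * π ^ besselOrder d = 2 * √π ^ d := by
    rw [sqrt_pi_pow, mul_assoc, ← rpow_one_add' pi_pos.le (by
      rw [besselOrder, add_sub_cancel]; positivity), besselOrder]
    ring_nf
  rw [show 2 * π * (π ^ besselOrder d * t ^ besselOrder d * ∑' m : ℕ, (-1) ^ m / ((m.factorial : ℝ) *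
    Gamma (besselOrder d + m + 1)) * (π * t) ^ (2 * m)) = t ^ besselOrder d * ((2 * π * π ^ besselOrder d) *
      ∑' m : ℕ, (-1) ^ m / ((m.factorial : ℝ) * Gamma (besselOrder d + m + 1)) * (π * t) ^ (2 * m)) by ring,
    hπ, ← tsum_mul_left]
  congr 1
  refine tsum_congr fun m => ?_
  have hG : 0 < Gamma (m + d / 2) := Gamma_pos_of_pos (by positivity)
  rw [add_zero, sphereMoment_eq m hu hd, show besselOrder d + m + 1 = m + d / 2 by
    rw [besselOrder]; ring]
  field_simp
  ring

/-- The difference of the two sphere integrals carries the weight `1 - ⟨u, ω⟩²`, which raises the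
order in Poisson's integral by one. Keeping `d - 1` on the left covers `d = 1`, where both sides
vanish. -/
theorem besselJ_succ {u : EuclideanSpace ℝ (Fin d)} (hu : ‖u‖ = 1) (hd : 0 < d)
    {t : ℝ} (ht : 0 < t) :
    (d - 1) * besselJ (besselOrder d + 1) (2 * π * t) =
      t ^ (besselOrder d + 1) * (sphereCos 0 u t - sphereCos 1 u t) := by
  have h := (hasSum_sphereCos 0 hu t).sub (hasSum_sphereCos 1 hu t)
  rw [← h.tsum_eq, besselJ, show 2 * π * t / 2 = π * t by ring, mul_rpow pi_pos.le ht.le]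
  have hπ : π ^ (besselOrder d + 1) = √π ^ d := by
    rw [sqrt_pi_pow, besselOrder]
    ring_nf
  rw [hπ, show ∀ S : ℝ, (d - 1) * (√π ^ d * t ^ (besselOrder d + 1) * S) =
    t ^ (besselOrder d + 1) * ((d - 1) * √π ^ d * S) from fun S => by ring, ← tsum_mul_left]
  congr 1
  refine tsum_congr fun m => ?_
  have hG : 0 < Gamma (m + d / 2 + 1) := Gamma_pos_of_pos (by positivity)
  rw [add_zero, ← mul_sub, sphereMoment_succ m hu hd,
    show besselOrder d + 1 + m + 1 = m + d / 2 + 1 by rw [besselOrder]; ring]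
  field_simp
  ring

end BesselSphere

/-! ### Bilinear forms invariant under the stabilizer of a unit vector. -/

section Invariant

variable {E : Type*} [NormedAddCommGroup E] [InnerProductSpace ℝ E]

theorem reflection_orthogonal_singleton_eq_self {u w : E} (h : inner ℝ u w = 0) :
    (ℝ ∙ w)ᗮ.reflection u = u :=
  Submodule.reflection_mem_subspace_eq_self (Submodule.mem_orthogonal_singleton_iff_inner_left.2 h)

/-- A symmetric bilinear form invariant under the isometries fixing the unit vector `u` is a
combination of `⟨u, ·⟩ ⟨u, ·⟩` and `⟨·, ·⟩ - ⟨u, ·⟩ ⟨u, ·⟩`. -/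
theorem exists_form_eq_of_invariant (T : E →ₗ[ℝ] E →ₗ[ℝ] ℝ) (hT : ∀ v w, T v w = T w v)
    {u : E} (hu : ‖u‖ = 1) (hinv : ∀ R : E ≃ₗᵢ[ℝ] E, R u = u → ∀ v w, T (R v) (R w) = T v w) :
    ∃ c : ℝ, ∀ v w, T v w = inner ℝ u v * inner ℝ u w * T u u +
      (inner ℝ v w - inner ℝ u v * inner ℝ u w) * c := by
  have huu : inner ℝ u u = (1 : ℝ) := by rw [real_inner_self_eq_norm_sq, hu, one_pow]
  -- Reflection in the hyperplane orthogonal to `w` fixes `u` and negates `w`, so `T u w = -T u w`.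
  have h1 : ∀ w, inner ℝ u w = 0 → T u w = 0 := fun w hw => by
    have h := hinv _ (reflection_orthogonal_singleton_eq_self hw) u w
    rw [reflection_orthogonal_singleton_eq_self hw,
      Submodule.reflection_orthogonalComplement_singleton_eq_neg, map_neg] at h
    linarith
  -- The reflection exchanging `w` and `w'` fixes `u`, because `w - w'` is orthogonal to `u`.
  have h2 : ∀ w w', inner ℝ u w = 0 → inner ℝ u w' = 0 → ‖w‖ = ‖w'‖ → T w w = T w' w' :=
    fun w w' hw hw' h => by
      have h' := hinv _ (reflection_orthogonal_singleton_eq_self (w := w - w')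
        (by rw [inner_sub_right, hw, hw', sub_zero])) w w
      rw [Submodule.reflection_sub h] at h'
      exact h'.symm
  obtain ⟨c, hc⟩ : ∃ c : ℝ, ∀ w, inner ℝ u w = 0 → T w w = ‖w‖ ^ 2 * c := by
    by_cases h : ∃ w₀ : E, inner ℝ u w₀ = 0 ∧ w₀ ≠ 0
    · obtain ⟨w₀, h₀, hne⟩ := h
      have hn : ‖w₀‖ ≠ 0 := norm_ne_zero_iff.2 hne
      refine ⟨T w₀ w₀ / ‖w₀‖ ^ 2, fun w hw => ?_⟩
      rw [h2 w ((‖w‖ / ‖w₀‖) • w₀) hw (by rw [inner_smul_right, h₀, mul_zero])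
        (by rw [norm_smul, norm_div, norm_norm, norm_norm, div_mul_cancel₀ _ hn])]
      simp only [map_smul, LinearMap.smul_apply, smul_eq_mul]
      field_simp
    · push Not at h
      refine ⟨0, fun w hw => ?_⟩
      simp [h w hw]
  have h4 : ∀ v, T v v = inner ℝ u v ^ 2 * T u u + (‖v‖ ^ 2 - inner ℝ u v ^ 2) * c := fun v => by
    have hw : inner ℝ u (v - (inner ℝ u v : ℝ) • u) = 0 := by
      rw [inner_sub_right, inner_smul_right, huu, mul_one, sub_self]
    have h5 := hc _ hw
    have h6 := h1 _ hw
    have h7 : ‖v - (inner ℝ u v : ℝ) • u‖ ^ 2 = ‖v‖ ^ 2 - inner ℝ u v ^ 2 := by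
      rw [norm_sub_sq_real, inner_smul_right, norm_smul, hu, real_inner_comm, mul_one,
        Real.norm_eq_abs, sq_abs]
      ring
    rw [h7] at h5
    simp only [map_sub, map_smul, LinearMap.sub_apply, LinearMap.smul_apply, smul_eq_mul,
      hT v u] at h5 h6
    linear_combination h5 + 2 * inner ℝ u v * h6
  -- The quadratic form is now known on the diagonal; polarization gives the bilinear form.
  refine ⟨c, fun v w => ?_⟩
  have h := h4 (v + w)
  rw [norm_add_sq_real, inner_add_right] at h
  simp only [map_add, LinearMap.add_apply, hT w v] at h
  linear_combination (h - h4 v - h4 w) / 2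

/-- The trace of the form is `T u u + (n - 1) c` with `n` the dimension, which determines the
unknown `c` when `n ≠ 1`; the multiplied form avoids the division. -/
theorem form_eq_of_invariant {ι : Type*} [Fintype ι] (b : OrthonormalBasis ι ℝ E)
    (T : E →ₗ[ℝ] E →ₗ[ℝ] ℝ) (hT : ∀ v w, T v w = T w v)
    {u : E} (hu : ‖u‖ = 1) (hinv : ∀ R : E ≃ₗᵢ[ℝ] E, R u = u → ∀ v w, T (R v) (R w) = T v w)
    (v w : E) :
    (Fintype.card ι - 1 : ℝ) * (T v w - inner ℝ u v * inner ℝ u w * T u u) =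
      (inner ℝ v w - inner ℝ u v * inner ℝ u w) * (∑ i, T (b i) (b i) - T u u) := by
  obtain ⟨c, hc⟩ := exists_form_eq_of_invariant T hT hu hinv
  have h1 : ∑ i, inner ℝ u (b i) * inner ℝ u (b i) = (1 : ℝ) := by
    simp only [← sq]
    rw [b.sum_sq_inner_left, hu, one_pow]
  have htr : ∑ i, T (b i) (b i) = T u u + (Fintype.card ι - 1) * c := by
    simp only [hc (b _) (b _)]
    rw [Finset.sum_add_distrib, ← Finset.sum_mul, ← Finset.sum_mul, Finset.sum_sub_distrib, h1]
    simp
  rw [htr, hc v w]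
  ring

end Invariant

/-! ### Radial Fourier integrals as Hankel integrals. -/

section Radial

open Set Metric Measure Real

variable {d : ℕ}

theorem integrable_radial_cos {g : ℝ → ℝ}
    (hg : Integrable fun x : EuclideanSpace ℝ (Fin d) => g ‖x‖) (v w ξ : EuclideanSpace ℝ (Fin d)) :
    Integrable fun x : EuclideanSpace ℝ (Fin d) =>
      g ‖x‖ * (inner ℝ v x * inner ℝ w x / ‖x‖ ^ 2 * cos (2 * π * inner ℝ ξ x)) := by
  refine hg.mul_bdd (c := ‖v‖ * ‖w‖) (Measurable.aestronglyMeasurable (by fun_prop))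
    (.of_forall fun x => ?_)
  rw [norm_mul, norm_div, norm_mul, norm_pow, norm_norm]
  refine (mul_le_mul ?_ (abs_cos_le_one _) (abs_nonneg _) (by positivity)).trans_eq (mul_one _)
  refine div_le_of_le_mul₀ (by positivity) (by positivity) ?_
  calc ‖inner ℝ v x‖ * ‖inner ℝ w x‖ ≤ (‖v‖ * ‖x‖) * (‖w‖ * ‖x‖) :=
        mul_le_mul (norm_inner_le_norm _ _) (norm_inner_le_norm _ _) (by positivity) (by positivity)
    _ = ‖v‖ * ‖w‖ * ‖x‖ ^ 2 := by ring

/-- The quotient `⟨u, x⟩ / ‖x‖` is constant along rays, so in polar coordinates only `g` and the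
cosine see the radius. -/
theorem integral_radial_cos (hd : 0 < d) (j : ℕ) {g : ℝ → ℝ}
    (hg : Integrable fun x : EuclideanSpace ℝ (Fin d) => g ‖x‖) {u : EuclideanSpace ℝ (Fin d)}
    (hu : ‖u‖ = 1) (ϱ : ℝ) :
    IntegrableOn (fun r => r ^ (d - 1) * (g r * sphereCos j u (ϱ * r))) (Ioi 0) ∧
    ∫ x, g ‖x‖ * ((inner ℝ u x / ‖x‖) ^ (2 * j) * cos (2 * π * ϱ * inner ℝ u x)) =
      ∫ r in Ioi (0 : ℝ), r ^ (d - 1) * (g r * sphereCos j u (ϱ * r)) := by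
  have : Nonempty (Fin d) := ⟨⟨0, hd⟩⟩
  have hint : Integrable fun x : EuclideanSpace ℝ (Fin d) =>
      g ‖x‖ * ((inner ℝ u x / ‖x‖) ^ (2 * j) * cos (2 * π * ϱ * inner ℝ u x)) := by
    refine hg.mul_bdd (c := 1) (Measurable.aestronglyMeasurable (by fun_prop))
      (.of_forall fun x => ?_)
    rw [norm_mul, norm_pow]
    refine mul_le_one₀ (pow_le_one₀ (norm_nonneg _) ?_) (norm_nonneg _) (abs_cos_le_one _)
    rw [norm_div, norm_norm]
    refine div_le_one_of_le₀ ?_ (norm_nonneg _)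
    simpa [hu] using norm_inner_le_norm (𝕜 := ℝ) u x
  have hpt : ∀ r ∈ Ioi (0 : ℝ), r ^ (Module.finrank ℝ (EuclideanSpace ℝ (Fin d)) - 1) *
      ∫ ω : sphere (0 : EuclideanSpace ℝ (Fin d)) 1, (g ‖r • (ω : EuclideanSpace ℝ (Fin d))‖ *
        ((inner ℝ u (r • (ω : EuclideanSpace ℝ (Fin d))) / ‖r • (ω : EuclideanSpace ℝ (Fin d))‖) ^ (2 * j) *
          cos (2 * π * ϱ * inner ℝ u (r • (ω : EuclideanSpace ℝ (Fin d))))))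
          ∂(volume : Measure _).toSphere =
      r ^ (d - 1) * (g r * sphereCos j u (ϱ * r)) := by
    intro r hr
    have hr : 0 < r := hr
    simp only [inner_smul_right, norm_smul, norm_eq_of_mem_sphere, mul_one,
      Real.norm_eq_abs, abs_of_pos hr, integral_const_mul, finrank_euclideanSpace_fin,
      mul_div_cancel_left₀ _ hr.ne', sphereCos]
    congr! 6
    ring
  constructor
  · exact (integrableOn_polar volume hint).congr_fun hpt measurableSet_Ioi
  · rw [integral_polar volume hint]
    exact setIntegral_congr_fun measurableSet_Ioi hpt

theorem hankelIntegrand_eq (hd : 0 < d) {u : EuclideanSpace ℝ (Fin d)} (hu : ‖u‖ = 1) (f : ℝ → ℝ)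
    {ϱ r : ℝ} (hϱ : 0 < ϱ) (hr : 0 < r) :
    hankelIntegrand d f ϱ r = ϱ ^ besselOrder d / (2 * π) *
      (r ^ (d - 1) * (f r * sphereCos 0 u (ϱ * r))) := by
  have h := two_pi_mul_besselJ hu hd (mul_pos hϱ hr)
  rw [mul_rpow hϱ.le hr.le] at h
  -- The Jacobian exponent is `d - 1 = 2μ + 1`; one part of it belongs to the Hankel integrand, the
  -- other to the power in Poisson's integral.
  have hpow : r ^ (d - 1) = r ^ (besselOrder d + 1) * r ^ besselOrder d := by
    rw [← rpow_add hr, ← rpow_natCast, Nat.cast_pred hd, besselOrder]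
    ring_nf
  rw [hankelIntegrand, hpow, mul_assoc (2 * π) ϱ r, div_mul_eq_mul_div, eq_div_iff (by positivity)]
  linear_combination r ^ (besselOrder d + 1) * f r * h

theorem hankelIntegrandSucc_eq (hd : 0 < d) {u : EuclideanSpace ℝ (Fin d)} (hu : ‖u‖ = 1)
    (f : ℝ → ℝ) {ϱ r : ℝ} (hϱ : 0 < ϱ) (hr : 0 < r) :
    (d - 1) * hankelIntegrandSucc d f ϱ r = ϱ ^ (besselOrder d + 1) *
      (r ^ (d - 1) * (f r * sphereCos 0 u (ϱ * r)) -
        r ^ (d - 1) * (f r * sphereCos 1 u (ϱ * r))) := by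
  have h := besselJ_succ hu hd (mul_pos hϱ hr)
  rw [mul_rpow hϱ.le hr.le] at h
  have hpow : r ^ (d - 1) = r ^ (besselOrder d + 1) * r ^ besselOrder d := by
    rw [← rpow_add hr, ← rpow_natCast, Nat.cast_pred hd, besselOrder]
    ring_nf
  rw [hankelIntegrandSucc, hpow, mul_assoc (2 * π) ϱ r]
  linear_combination r ^ besselOrder d * f r * h

/-- The Fourier integral of `g(‖x‖) (⟨u, x⟩ / ‖x‖) ^ (2 j)` at the point `ϱ u`. -/
noncomputable def radialCos (j : ℕ) (g : ℝ → ℝ) (u : EuclideanSpace ℝ (Fin d)) (ϱ : ℝ) : ℝ :=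
  ∫ x, g ‖x‖ * ((inner ℝ u x / ‖x‖) ^ (2 * j) * cos (2 * π * ϱ * inner ℝ u x))

theorem integrableOn_hankelIntegrand (hd : 0 < d) {g : ℝ → ℝ}
    (hg : Integrable fun x : EuclideanSpace ℝ (Fin d) => g ‖x‖) {ϱ : ℝ} (hϱ : 0 < ϱ) :
    IntegrableOn (hankelIntegrand d g ϱ) (Ioi 0) := by
  have hu : ‖EuclideanSpace.single (⟨0, hd⟩ : Fin d) (1 : ℝ)‖ = 1 := by simp
  exact IntegrableOn.congr_fun ((integral_radial_cos hd 0 hg hu ϱ).1.const_mul _)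
    (fun r hr => (hankelIntegrand_eq hd hu g hϱ hr).symm) measurableSet_Ioi

theorem integral_hankelIntegrand (hd : 0 < d) {g : ℝ → ℝ}
    (hg : Integrable fun x : EuclideanSpace ℝ (Fin d) => g ‖x‖) {u : EuclideanSpace ℝ (Fin d)}
    (hu : ‖u‖ = 1) {ϱ : ℝ} (hϱ : 0 < ϱ) :
    2 * π / ϱ ^ besselOrder d * (∫ r in Ioi (0 : ℝ), hankelIntegrand d g ϱ r) =
      radialCos 0 g u ϱ := by
  rw [setIntegral_congr_fun measurableSet_Ioi
    (fun r hr => hankelIntegrand_eq hd hu g hϱ hr), integral_const_mul,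
    ← (integral_radial_cos hd 0 hg hu ϱ).2, radialCos]
  have := rpow_pos_of_pos hϱ (besselOrder d)
  rw [← mul_assoc, div_mul_div_cancel₀ this.ne', div_self (by positivity), one_mul]

theorem integrableOn_hankelIntegrandSucc (hd : 2 ≤ d) {g : ℝ → ℝ}
    (hg : Integrable fun x : EuclideanSpace ℝ (Fin d) => g ‖x‖) {ϱ : ℝ} (hϱ : 0 < ϱ) :
    IntegrableOn (hankelIntegrandSucc d g ϱ) (Ioi 0) := by
  have hd0 : 0 < d := by omega
  have hd1 : (d : ℝ) - 1 ≠ 0 := by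
    have : (2 : ℝ) ≤ d := by exact_mod_cast hd
    linarith
  have hu : ‖EuclideanSpace.single (⟨0, hd0⟩ : Fin d) (1 : ℝ)‖ = 1 := by simp
  refine IntegrableOn.congr_fun ((((integral_radial_cos hd0 0 hg hu ϱ).1.sub
    (integral_radial_cos hd0 1 hg hu ϱ).1).const_mul (ϱ ^ (besselOrder d + 1))).const_mul
      ((d : ℝ) - 1)⁻¹) (fun r hr => ?_) measurableSet_Ioi
  have h := hankelIntegrandSucc_eq hd0 hu g hϱ hr
  simp only [Pi.sub_apply]
  rw [← h, inv_mul_cancel_left₀ hd1]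

theorem integral_hankelIntegrandSucc (hd : 0 < d) {g : ℝ → ℝ}
    (hg : Integrable fun x : EuclideanSpace ℝ (Fin d) => g ‖x‖) {u : EuclideanSpace ℝ (Fin d)}
    (hu : ‖u‖ = 1) {ϱ : ℝ} (hϱ : 0 < ϱ) :
    (d - 1) / ϱ ^ (besselOrder d + 1) * (∫ r in Ioi (0 : ℝ), hankelIntegrandSucc d g ϱ r) =
      radialCos 0 g u ϱ - radialCos 1 g u ϱ := by
  have := rpow_pos_of_pos hϱ (besselOrder d + 1)
  rw [div_mul_eq_mul_div, ← integral_const_mul, setIntegral_congr_fun measurableSet_Ioi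
    (fun r hr => hankelIntegrandSucc_eq hd hu g hϱ hr), integral_const_mul,
    integral_sub (integral_radial_cos hd 0 hg hu ϱ).1 (integral_radial_cos hd 1 hg hu ϱ).1,
    ← (integral_radial_cos hd 0 hg hu ϱ).2, ← (integral_radial_cos hd 1 hg hu ϱ).2,
    radialCos, radialCos, mul_div_cancel_left₀ _ this.ne']

end Radial

/-! ### The cosine transform of even functions. -/

section CosTransform

open Real

variable {V : Type*} [NormedAddCommGroup V] [InnerProductSpace ℝ V] [MeasurableSpace V]
  [BorelSpace V] [FiniteDimensional ℝ V]

/-- The cosine transform `∫ f(x) cos(2π ⟨ξ, x⟩) dx`. -/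
noncomputable def cosTransform (f : V → ℝ) (ξ : V) : ℝ := ∫ x, f x * cos (2 * π * inner ℝ ξ x)

theorem integrable_mul_cos {f : V → ℝ} (hf : Integrable f) (ξ : V) :
    Integrable fun x => f x * cos (2 * π * inner ℝ ξ x) :=
  hf.mul_bdd (c := 1) (Continuous.aestronglyMeasurable (by fun_prop))
    (.of_forall fun _ => abs_cos_le_one _)

theorem integral_eq_zero_of_odd {f : V → ℝ} (hf : ∀ x, f (-x) = -f x) : ∫ x, f x = 0 := by
  have h := integral_neg_eq_self f volume
  simp only [hf, integral_neg] at h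
  linarith

/-- The Fourier transform of an even function is its cosine transform. -/
theorem fourier_eq_cosTransform {f : V → ℝ} (hf : Integrable f) (heven : ∀ x, f (-x) = f x)
    (ξ : V) : 𝓕 (fun x => (f x : ℂ)) ξ = (cosTransform f ξ : ℂ) := by
  have hs : Integrable fun x => f x * sin (2 * π * inner ℝ ξ x) :=
    hf.mul_bdd (c := 1) (Continuous.aestronglyMeasurable (by fun_prop))
      (.of_forall fun _ => abs_sin_le_one _)
  have hodd : ∫ x, f x * sin (2 * π * inner ℝ ξ x) = 0 := integral_eq_zero_of_odd fun x => by
    rw [heven, inner_neg_right, mul_neg, sin_neg, mul_neg]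
  rw [Real.fourier_eq']
  have hpt : ∀ x : V, Complex.exp (↑(-2 * π * inner ℝ x ξ) * Complex.I) • (f x : ℂ) =
      ((f x * cos (2 * π * inner ℝ ξ x) : ℝ) : ℂ) -
        ((f x * sin (2 * π * inner ℝ ξ x) : ℝ) : ℂ) * Complex.I := fun x => by
    rw [Complex.exp_mul_I, ← Complex.ofReal_cos, ← Complex.ofReal_sin, real_inner_comm, neg_mul,
      neg_mul, cos_neg, sin_neg, smul_eq_mul]
    push_cast
    ring
  simp only [hpt]
  rw [integral_sub (integrable_mul_cos hf ξ).ofReal (hs.ofReal.mul_const _), integral_mul_const,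
    integral_complex_ofReal, integral_complex_ofReal, hodd, cosTransform]
  simp

end CosTransform

/-! ### The transform of a matrix function with coefficients. -/

section Coefficients

open Real

variable {d : ℕ} {k : EuclideanSpace ℝ (Fin d) → Matrix (Fin d) (Fin d) ℝ} {kpar kperp : ℝ → ℝ}

theorem prPar_apply (x : EuclideanSpace ℝ (Fin d)) (i j : Fin d) :
    prPar x i j = x i * x j / ‖x‖ ^ 2 := by
  simp [prPar, Matrix.vecMulVec_apply, div_eq_inv_mul]

theorem prPar_neg (x : EuclideanSpace ℝ (Fin d)) : prPar (-x) = prPar x := by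
  ext i j
  simp [prPar_apply]

theorem HasCoefficients.apply_neg (h : HasCoefficients k kpar kperp)
    (x : EuclideanSpace ℝ (Fin d)) : k (-x) = k x := by
  by_cases hx : x = 0
  · rw [hx, neg_zero]
  · rw [h x hx, h (-x) (neg_ne_zero.2 hx), prPerp, prPerp, prPar_neg, norm_neg]

theorem HasCoefficients.apply (h : HasCoefficients k kpar kperp)
    {x : EuclideanSpace ℝ (Fin d)} (hx : x ≠ 0) (i j : Fin d) :
    k x i j = kperp ‖x‖ * (1 : Matrix (Fin d) (Fin d) ℝ) i j +
      (kpar ‖x‖ - kperp ‖x‖) * (x i * x j / ‖x‖ ^ 2) := by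
  rw [h x hx]
  simp only [prPerp, Matrix.add_apply, Matrix.smul_apply, Matrix.sub_apply, prPar_apply, smul_eq_mul]
  ring

theorem HasCoefficients.apply_comm (h : HasCoefficients k kpar kperp)
    {x : EuclideanSpace ℝ (Fin d)} (hx : x ≠ 0) (i j : Fin d) : k x i j = k x j i := by
  rw [h.apply hx, h.apply hx, ← Matrix.transpose_apply (1 : Matrix (Fin d) (Fin d) ℝ) i j,
    Matrix.transpose_one]
  ring

/-- Pairing `k x` with the projection onto `x` kills the perpendicular part. This writes `kpar` as a
combination of the entries with bounded weights, so integrability and measurability pass to it. -/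
theorem HasCoefficients.sum_apply_mul (h : HasCoefficients k kpar kperp)
    {x : EuclideanSpace ℝ (Fin d)} (hx : x ≠ 0) :
    ∑ i, ∑ j, k x i j * (x i * x j / ‖x‖ ^ 2) = kpar ‖x‖ := by
  have hn : ‖x‖ ≠ 0 := norm_ne_zero_iff.2 hx
  have h1 : ∑ i, x i ^ 2 = ‖x‖ ^ 2 := (EuclideanSpace.real_norm_sq_eq x).symm
  have h2 : ∀ i j, k x i j * (x i * x j / ‖x‖ ^ 2) =
      (1 : Matrix (Fin d) (Fin d) ℝ) i j * (kperp ‖x‖ * (x i * x j / ‖x‖ ^ 2)) +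
      (kpar ‖x‖ - kperp ‖x‖) / ‖x‖ ^ 4 * (x i ^ 2 * x j ^ 2) := fun i j => by
    rw [h.apply hx]
    field_simp
  simp only [h2, Finset.sum_add_distrib, ← Finset.mul_sum, h1, Matrix.one_apply, ite_mul, one_mul,
    zero_mul, Finset.sum_ite_eq, Finset.mem_univ, if_true, ← Finset.sum_mul]
  simp only [← sq, ← Finset.sum_div, h1]
  field_simp
  ring

theorem HasCoefficients.trace (h : HasCoefficients k kpar kperp)
    {x : EuclideanSpace ℝ (Fin d)} (hx : x ≠ 0) :
    ∑ i, k x i i = kpar ‖x‖ + (d - 1) * kperp ‖x‖ := by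
  have hn : ‖x‖ ≠ 0 := norm_ne_zero_iff.2 hx
  have h1 : ∑ i, x i ^ 2 = ‖x‖ ^ 2 := (EuclideanSpace.real_norm_sq_eq x).symm
  simp only [h.apply hx, Finset.sum_add_distrib, ← Finset.mul_sum, Matrix.one_apply_eq, ← sq,
    ← Finset.sum_div, h1]
  simp
  field_simp
  ring

theorem ae_ne_zero (hd : 0 < d) : ∀ᵐ x : EuclideanSpace ℝ (Fin d), x ≠ 0 := by
  have : Nonempty (Fin d) := ⟨⟨0, hd⟩⟩
  exact Measure.ae_ne volume 0

theorem HasCoefficients.integrable_par (hd : 0 < d) (h : HasCoefficients k kpar kperp)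
    (hk : ∀ i j, Integrable (fun x => k x i j)) :
    Integrable fun x : EuclideanSpace ℝ (Fin d) => kpar ‖x‖ := by
  have h1 : Integrable fun x => ∑ i, ∑ j, k x i j * (x i * x j / ‖x‖ ^ 2) := by
    refine integrable_finsetSum _ fun i _ => integrable_finsetSum _ fun j _ =>
      (hk i j).mul_bdd (c := 1) (Measurable.aestronglyMeasurable (by fun_prop))
        (.of_forall fun x => ?_)
    rw [norm_div, norm_mul, norm_pow, norm_norm]
    refine div_le_one_of_le₀ ?_ (by positivity)
    rw [sq]
    exact mul_le_mul (PiLp.norm_apply_le x i) (PiLp.norm_apply_le x j) (norm_nonneg _) (norm_nonneg _)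
  refine h1.congr ?_
  filter_upwards [ae_ne_zero hd] with x hx using h.sum_apply_mul hx

theorem HasCoefficients.integrable_perp (hd : 2 ≤ d) (h : HasCoefficients k kpar kperp)
    (hk : ∀ i j, Integrable (fun x => k x i j)) :
    Integrable fun x : EuclideanSpace ℝ (Fin d) => kperp ‖x‖ := by
  have hd1 : (d : ℝ) - 1 ≠ 0 := by
    have : (2 : ℝ) ≤ d := by exact_mod_cast hd
    linarith
  refine (((integrable_finsetSum Finset.univ fun i _ => hk i i).sub
    (h.integrable_par (by omega) hk)).const_mul ((d : ℝ) - 1)⁻¹).congr ?_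
  filter_upwards [ae_ne_zero (by omega : 0 < d)] with x hx
  simp only [Pi.sub_apply, h.trace hx]
  field_simp
  ring

/-- The bilinear form `∫ g(‖x‖) ⟨v, x⟩ ⟨w, x⟩ / ‖x‖² cos(2π ⟨ξ, x⟩) dx`. -/
noncomputable def radialForm {g : ℝ → ℝ}
    (hg : Integrable fun x : EuclideanSpace ℝ (Fin d) => g ‖x‖) (ξ : EuclideanSpace ℝ (Fin d)) :
    EuclideanSpace ℝ (Fin d) →ₗ[ℝ] EuclideanSpace ℝ (Fin d) →ₗ[ℝ] ℝ :=
  LinearMap.mk₂ ℝ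
    (fun v w => ∫ x : EuclideanSpace ℝ (Fin d),
      g ‖x‖ * (inner ℝ v x * inner ℝ w x / ‖x‖ ^ 2 * cos (2 * π * inner ℝ ξ x)))
    (fun v v' w => by
      rw [← integral_add (integrable_radial_cos hg _ _ _) (integrable_radial_cos hg _ _ _)]
      refine integral_congr_ae (.of_forall fun x => ?_)
      simp only [inner_add_left]
      ring)
    (fun a v w => by
      rw [smul_eq_mul, ← integral_const_mul]
      refine integral_congr_ae (.of_forall fun x => ?_)
      simp only [real_inner_smul_left]
      ring)
    (fun v w w' => by
      rw [← integral_add (integrable_radial_cos hg _ _ _) (integrable_radial_cos hg _ _ _)]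
      refine integral_congr_ae (.of_forall fun x => ?_)
      simp only [inner_add_left]
      ring)
    (fun a v w => by
      rw [smul_eq_mul, ← integral_const_mul]
      refine integral_congr_ae (.of_forall fun x => ?_)
      simp only [real_inner_smul_left]
      ring)

theorem radialForm_apply {g : ℝ → ℝ}
    (hg : Integrable fun x : EuclideanSpace ℝ (Fin d) => g ‖x‖) (ξ v w : EuclideanSpace ℝ (Fin d)) :
    radialForm hg ξ v w = ∫ x : EuclideanSpace ℝ (Fin d),
      g ‖x‖ * (inner ℝ v x * inner ℝ w x / ‖x‖ ^ 2 * cos (2 * π * inner ℝ ξ x)) := rfl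

theorem radialForm_comm {g : ℝ → ℝ}
    (hg : Integrable fun x : EuclideanSpace ℝ (Fin d) => g ‖x‖) (ξ v w : EuclideanSpace ℝ (Fin d)) :
    radialForm hg ξ v w = radialForm hg ξ w v := by
  simp only [radialForm_apply, mul_comm (inner ℝ v _)]

/-- Substituting `R x` for `x` preserves Lebesgue measure, norms and inner products, and `R` fixes
the frequency. -/
theorem radialForm_map {g : ℝ → ℝ}
    (hg : Integrable fun x : EuclideanSpace ℝ (Fin d) => g ‖x‖) {u : EuclideanSpace ℝ (Fin d)}
    (ϱ : ℝ) (R : EuclideanSpace ℝ (Fin d) ≃ₗᵢ[ℝ] EuclideanSpace ℝ (Fin d)) (hR : R u = u)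
    (v w : EuclideanSpace ℝ (Fin d)) :
    radialForm hg (ϱ • u) (R v) (R w) = radialForm hg (ϱ • u) v w := by
  have hR' : R (ϱ • u) = ϱ • u := by rw [map_smul, hR]
  rw [radialForm_apply, ← R.measurePreserving.integral_comp R.toMeasurableEquiv.measurableEmbedding]
  rw [← hR']
  simp only [R.inner_map_map, R.norm_map]
  rw [hR', radialForm_apply]

/-- Here `radialCos 1` is the value of the form at `(u, u)`, and `radialCos 0` is its trace, since
the squared coordinates of `x` add up to `‖x‖²`. -/
theorem radialForm_eq (hd : 0 < d) {g : ℝ → ℝ}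
    (hg : Integrable fun x : EuclideanSpace ℝ (Fin d) => g ‖x‖) {u : EuclideanSpace ℝ (Fin d)}
    (hu : ‖u‖ = 1) (ϱ : ℝ) (v w : EuclideanSpace ℝ (Fin d)) :
    (d - 1) * (radialForm hg (ϱ • u) v w - inner ℝ u v * inner ℝ u w * radialCos 1 g u ϱ) =
      (inner ℝ v w - inner ℝ u v * inner ℝ u w) * (radialCos 0 g u ϱ - radialCos 1 g u ϱ) := by
  have h := form_eq_of_invariant (EuclideanSpace.basisFun (Fin d) ℝ) (radialForm hg (ϱ • u))
    (radialForm_comm hg _) hu (fun R hR => radialForm_map hg ϱ R hR) v w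
  have h1 : radialForm hg (ϱ • u) u u = radialCos 1 g u ϱ := by
    rw [radialForm_apply, radialCos]
    refine integral_congr_ae (.of_forall fun x => ?_)
    simp only [real_inner_smul_left, div_pow, mul_one]
    ring_nf
  have h0 : ∑ i, radialForm hg (ϱ • u) (EuclideanSpace.basisFun (Fin d) ℝ i)
      (EuclideanSpace.basisFun (Fin d) ℝ i) = radialCos 0 g u ϱ := by
    simp only [radialForm_apply]
    rw [← integral_finsetSum _ fun i _ => integrable_radial_cos hg _ _ _, radialCos]
    refine integral_congr_ae ?_
    filter_upwards [ae_ne_zero hd] with x hx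
    have hn : ‖x‖ ≠ 0 := norm_ne_zero_iff.2 hx
    rw [← Finset.mul_sum, ← Finset.sum_mul, ← Finset.sum_div]
    simp only [← sq]
    rw [OrthonormalBasis.sum_sq_inner_right, div_self (pow_ne_zero 2 hn), real_inner_smul_left]
    simp [mul_assoc]
  rw [h1, h0, Fintype.card_fin] at h
  exact h

theorem radialCos_sub {f g : ℝ → ℝ}
    (hf : Integrable fun x : EuclideanSpace ℝ (Fin d) => f ‖x‖)
    (hg : Integrable fun x : EuclideanSpace ℝ (Fin d) => g ‖x‖) (u : EuclideanSpace ℝ (Fin d))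
    (ϱ : ℝ) : radialCos 0 (fun r => f r - g r) u ϱ = radialCos 0 f u ϱ - radialCos 0 g u ϱ := by
  have h : ∀ {g : ℝ → ℝ}, Integrable (fun x : EuclideanSpace ℝ (Fin d) => g ‖x‖) →
      Integrable fun x => g ‖x‖ * ((inner ℝ u x / ‖x‖) ^ (2 * 0) * cos (2 * π * ϱ * inner ℝ u x)) :=
    fun hg => by
      simp only [mul_zero, pow_zero, one_mul]
      exact hg.mul_bdd (c := 1) (Continuous.aestronglyMeasurable (by fun_prop))
        (.of_forall fun _ => abs_cos_le_one _)
  rw [radialCos, radialCos, radialCos, ← integral_sub (h hf) (h hg)]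
  simp only [sub_mul]

/-- As `2μ + 1 = d - 1`, the second Hankel term is `radialCos 0 - radialCos 1` of `kpar - kperp`,
and its `radialCos 0` part turns `kpar` into `kperp` in the first term. -/
theorem hPar_eq (hd : 2 ≤ d)
    (hpar : Integrable fun x : EuclideanSpace ℝ (Fin d) => kpar ‖x‖)
    (hperp : Integrable fun x : EuclideanSpace ℝ (Fin d) => kperp ‖x‖)
    {u : EuclideanSpace ℝ (Fin d)} (hu : ‖u‖ = 1) {ϱ : ℝ} (hϱ : 0 < ϱ) :
    hPar d kpar kperp ϱ = radialCos 0 kperp u ϱ + radialCos 1 (fun s => kpar s - kperp s) u ϱ := by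
  rw [hPar, integral_hankelIntegrand (by omega) hpar hu hϱ,
    show 2 * besselOrder d + 1 = d - 1 by rw [besselOrder]; ring,
    integral_hankelIntegrandSucc (g := fun s => kpar s - kperp s) (by omega) (hpar.sub hperp) hu hϱ,
    radialCos_sub hpar hperp]
  ring

theorem hPerp_eq (hd : 2 ≤ d)
    (hpar : Integrable fun x : EuclideanSpace ℝ (Fin d) => kpar ‖x‖)
    (hperp : Integrable fun x : EuclideanSpace ℝ (Fin d) => kperp ‖x‖)
    {u : EuclideanSpace ℝ (Fin d)} (hu : ‖u‖ = 1) {ϱ : ℝ} (hϱ : 0 < ϱ) :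
    (d - 1) * hPerp d kpar kperp ϱ = (d - 1) * radialCos 0 kperp u ϱ +
      (radialCos 0 (fun s => kpar s - kperp s) u ϱ -
        radialCos 1 (fun s => kpar s - kperp s) u ϱ) := by
  rw [hPerp, integral_hankelIntegrand (by omega) hperp hu hϱ,
    ← integral_hankelIntegrandSucc (g := fun s => kpar s - kperp s) (by omega)
      (hpar.sub hperp) hu hϱ]
  ring

/-- The cosine transform of a matrix function with coefficients has the same form, with the
coefficients `hPar` and `hPerp`. -/
theorem HasCoefficients.cosTransform_apply (hd : 2 ≤ d) (h : HasCoefficients k kpar kperp)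
    (hk : ∀ i j, Integrable (fun x => k x i j)) {ξ : EuclideanSpace ℝ (Fin d)} (hξ : ξ ≠ 0)
    (i j : Fin d) :
    cosTransform (fun x => k x i j) ξ =
      (hPar d kpar kperp ‖ξ‖ • prPar ξ + hPerp d kpar kperp ‖ξ‖ • prPerp ξ) i j := by
  have hd1 : (d : ℝ) - 1 ≠ 0 := by
    have : (2 : ℝ) ≤ d := by exact_mod_cast hd
    linarith
  have hpar := h.integrable_par (by omega) hk
  have hperp := h.integrable_perp hd hk
  have hG : Integrable fun x : EuclideanSpace ℝ (Fin d) => (fun s => kpar s - kperp s) ‖x‖ :=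
    hpar.sub hperp
  have hϱ : 0 < ‖ξ‖ := norm_pos_iff.2 hξ
  set u : EuclideanSpace ℝ (Fin d) := ‖ξ‖⁻¹ • ξ with hudef
  have hu : ‖u‖ = 1 := norm_smul_inv_norm hξ
  have hξu : ξ = ‖ξ‖ • u := by rw [hudef, smul_smul, mul_inv_cancel₀ hϱ.ne', one_smul]
  have hcos : cosTransform (fun x => k x i j) ξ =
      (1 : Matrix (Fin d) (Fin d) ℝ) i j * radialCos 0 kperp u ‖ξ‖ +
      radialForm (g := fun s => kpar s - kperp s) hG (‖ξ‖ • u) (EuclideanSpace.basisFun (Fin d) ℝ i)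
        (EuclideanSpace.basisFun (Fin d) ℝ j) := by
    rw [← hξu, radialForm_apply, radialCos, ← integral_const_mul, ← integral_add,
      cosTransform]
    · refine integral_congr_ae ?_
      filter_upwards [ae_ne_zero (by omega : 0 < d)] with x hx
      have : 2 * π * ‖ξ‖ * inner ℝ u x = 2 * π * inner ℝ ξ x := by
        conv_rhs => rw [hξu, real_inner_smul_left]
        ring
      simp only [h.apply hx, this, EuclideanSpace.basisFun_apply, EuclideanSpace.inner_single_left]
      simp
      ring
    · simp only [mul_zero, pow_zero, one_mul]
      exact (hperp.mul_bdd (c := 1) (Continuous.aestronglyMeasurable (by fun_prop))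
        (.of_forall fun _ => abs_cos_le_one _)).const_mul _
    · exact integrable_radial_cos (g := fun s => kpar s - kperp s) hG _ _ _
  have hform := radialForm_eq (g := fun s => kpar s - kperp s) (by omega) hG hu ‖ξ‖ (EuclideanSpace.basisFun (Fin d) ℝ i)
    (EuclideanSpace.basisFun (Fin d) ℝ j)
  have hin : ∀ i, inner ℝ u (EuclideanSpace.basisFun (Fin d) ℝ i) = u i := fun i => by
    simp [EuclideanSpace.basisFun_apply, EuclideanSpace.inner_single_right]
  have hij : inner ℝ (EuclideanSpace.basisFun (Fin d) ℝ i) (EuclideanSpace.basisFun (Fin d) ℝ j) =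
      (1 : Matrix (Fin d) (Fin d) ℝ) i j := by
    simp [EuclideanSpace.basisFun_apply, EuclideanSpace.inner_single_right, Matrix.one_apply,
      eq_comm]
  rw [hin, hin, hij] at hform
  have hpr : prPar ξ i j = u i * u j := by
    rw [prPar_apply, hudef]
    simp only [PiLp.smul_apply, smul_eq_mul]
    field_simp
  simp only [prPerp, Matrix.add_apply, Matrix.smul_apply, Matrix.sub_apply, smul_eq_mul, hpr]
  rw [hPar_eq hd hpar hperp hu hϱ, hcos]
  have hP := hPerp_eq hd hpar hperp hu hϱ
  apply mul_left_cancel₀ hd1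
  linear_combination hform - ((1 : Matrix (Fin d) (Fin d) ℝ) i j - u i * u j) * hP

/-- The Fourier transform of a matrix function with coefficients. -/
theorem HasCoefficients.matrixFourier_eq (hd : 2 ≤ d) (h : HasCoefficients k kpar kperp)
    (hk : ∀ i j, Integrable (fun x => k x i j)) {ξ : EuclideanSpace ℝ (Fin d)} (hξ : ξ ≠ 0) :
    matrixFourier k ξ =
        (hPar d kpar kperp ‖ξ‖ • prPar ξ + hPerp d kpar kperp ‖ξ‖ • prPerp ξ).map
          (fun t : ℝ => (t : ℂ)) := by
  ext i j
  rw [matrixFourier, Matrix.of_apply, fourier_eq_cosTransform (hk i j)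
    (fun x => by rw [h.apply_neg]), h.cosTransform_apply hd hk hξ, Matrix.map_apply]

end Coefficients

/-! ### From positive double sums to positive integrals. -/

section Sampling

open Real Filter Topology

/-- If all sums `∑ F(x_a, x_b)` over finite families of points are nonnegative, then so is the
integral of `F` over a product of two copies of a probability measure. -/
theorem integral_prod_nonneg_of_sum_nonneg {Ω : Type*} [MeasurableSpace Ω] (P : Measure Ω)
    [IsProbabilityMeasure P] {F : Ω × Ω → ℝ} (hF : Integrable F (P.prod P))
    (hdiag : Integrable (fun x => F (x, x)) P)
    (hpos : ∀ (N : ℕ) (x : Fin N → Ω), 0 ≤ ∑ a, ∑ b, F (x a, x b)) :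
    0 ≤ ∫ p, F p ∂(P.prod P) := by
  set I := ∫ p, F p ∂(P.prod P)
  set D := ∫ x, F (x, x) ∂P
  -- Expectation of the double sum at `N` independent points: the `N` diagonal pairs contribute `D`
  -- each, the `N (N - 1)` others `I` each.
  have key : ∀ N : ℕ, 0 ≤ (N : ℝ) * D + ((N : ℝ) * (N - 1)) * I := fun N => by
    let Q : Measure (Fin N → Ω) := Measure.pi fun _ => P
    have hd (a : Fin N) : MeasurePreserving (fun x : Fin N → Ω => x a) Q P :=
      measurePreserving_eval _ a
    have ho (a b : Fin N) (hab : a ≠ b) :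
        MeasurePreserving (fun x : Fin N → Ω => (x a, x b)) Q (P.prod P) := by
      refine ⟨by fun_prop, ?_⟩
      have hind := (ProbabilityTheory.iIndepFun_pi (μ := fun _ : Fin N => P)
        (X := fun _ => id) (fun _ => aemeasurable_id)).indepFun hab
      simp only [id] at hind
      rw [ProbabilityTheory.indepFun_iff_map_prod_eq_prod_map_map (measurable_pi_apply a).aemeasurable
        (measurable_pi_apply b).aemeasurable] at hind
      rw [(hd a).map_eq, (hd b).map_eq] at hind
      exact hind
    have hint (a b : Fin N) : Integrable (fun x : Fin N → Ω => F (x a, x b)) Q := by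
      by_cases hab : a = b
      · subst hab
        exact (hd a).integrable_comp_of_integrable hdiag
      · exact (ho a b hab).integrable_comp_of_integrable hF
    have hval (a b : Fin N) : ∫ x, F (x a, x b) ∂Q = if a = b then D else I := by
      split_ifs with hab
      · subst hab
        have h := integral_map (hd a).measurable.aemeasurable (f := fun x => F (x, x))
          (by rw [(hd a).map_eq]; exact hdiag.1)
        rw [(hd a).map_eq] at h
        exact h.symm
      · have h := integral_map (ho a b hab).measurable.aemeasurable (f := F)
          (by rw [(ho a b hab).map_eq]; exact hF.1)
        rw [(ho a b hab).map_eq] at h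
        exact h.symm
    have h0 : 0 ≤ ∫ x, ∑ a, ∑ b, F (x a, x b) ∂Q := integral_nonneg fun x => hpos N x
    rw [integral_finsetSum _ fun a _ => integrable_finsetSum _ fun b _ => hint a b] at h0
    simp only [integral_finsetSum _ fun b _ => hint _ b, hval] at h0
    refine h0.trans_eq ?_
    have h1 : ∀ a : Fin N, ∑ b, (if a = b then D else I) = D + (N - 1) * I := fun a => by
      have : ∀ b : Fin N, (if a = b then D else I) = I + if a = b then D - I else 0 := fun b => by
        split_ifs <;> ring
      simp only [this, Finset.sum_add_distrib, Finset.sum_ite_eq, Finset.mem_univ, if_true,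
        Finset.sum_const, Finset.card_univ, Fintype.card_fin, nsmul_eq_mul]
      ring
    simp only [h1, Finset.sum_const, Finset.card_univ, Fintype.card_fin, nsmul_eq_mul]
    ring
  by_contra! hI
  -- For negative `I` this choice makes `D + n * I` negative, contradicting `key` at `n + 1`.
  obtain ⟨n, hn⟩ := exists_nat_gt (D / -I)
  have h1 := key (n + 1)
  rw [div_lt_iff₀ (by linarith)] at hn
  push_cast at h1
  have : 0 < ((n : ℝ) + 1) * (-(D + n * I)) := mul_pos (by positivity) (by linarith)
  nlinarith

variable {V : Type*} [NormedAddCommGroup V] [InnerProductSpace ℝ V] [MeasurableSpace V]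
  [BorelSpace V] [FiniteDimensional ℝ V]

theorem integrable_exp_neg_mul_sq_norm {a : ℝ} (ha : 0 < a) :
    Integrable fun x : V => exp (-a * ‖x‖ ^ 2) := by
  have h := (GaussianFourier.integrable_cexp_neg_mul_sq_norm_add (V := V) (b := a) (by simpa) 0 0).re
  refine h.congr (.of_forall fun x => ?_)
  have : -(a : ℂ) * (‖x‖ : ℂ) ^ 2 + 0 * ((inner ℝ (0 : V) x : ℝ) : ℂ) = ((-a * ‖x‖ ^ 2 : ℝ) : ℂ) := by
    push_cast; ring
  simp only [this, ← Complex.ofReal_exp]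
  rfl

theorem integral_exp_neg_mul_sq_norm_pos {a : ℝ} (ha : 0 < a) :
    0 < ∫ x : V, exp (-a * ‖x‖ ^ 2) :=
  integral_exp_pos (integrable_exp_neg_mul_sq_norm ha)

/-- Sample points with density proportional to `exp (-a ‖x‖²)`. The difference of two independent
ones has density proportional to the Gaussian in the conclusion. -/
theorem integral_mul_gaussian_nonneg {f : V → ℝ} (hf : Integrable f)
    (hpos : ∀ (N : ℕ) (x : Fin N → V), 0 ≤ ∑ a, ∑ b, f (x a - x b)) {a : ℝ} (ha : 0 < a) :
    0 ≤ ∫ z, f z * exp (-(a / 2) * ‖z‖ ^ 2) := by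
  set g : V → ℝ := fun x => exp (-a * ‖x‖ ^ 2) with hg
  have hgi : Integrable g := integrable_exp_neg_mul_sq_norm ha
  have hC : 0 < ∫ x, g x := integral_exp_neg_mul_sq_norm_pos ha
  set C := ∫ x, g x
  set w : V → ℝ := fun x => C⁻¹ * g x
  have hw0 : ∀ x, 0 ≤ w x := fun x => by positivity
  have hwm : Measurable fun x => ENNReal.ofReal (w x) := by fun_prop
  have hwi : Integrable w := hgi.const_mul _
  let P : Measure V := volume.withDensity fun x => ENNReal.ofReal (w x)
  have hP : IsProbabilityMeasure P := by
    refine ⟨?_⟩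
    rw [withDensity_apply _ MeasurableSet.univ, Measure.restrict_univ,
      ← ofReal_integral_eq_lintegral_ofReal hwi (.of_forall hw0), integral_const_mul,
      inv_mul_cancel₀ hC.ne', ENNReal.ofReal_one]
  have hPP : P.prod P = (volume.prod volume).withDensity
      fun p : V × V => ENNReal.ofReal (w p.1 * w p.2) := by
    rw [prod_withDensity hwm hwm]
    simp only [ENNReal.ofReal_mul (hw0 _)]
  -- The integrand after the shear `(x, y) ↦ (x - y, y)`, in which `f` depends on the first variable
  -- only.
  let H : V × V → ℝ := fun p => f p.1 * w p.2 * w (p.1 + p.2)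
  have hH : Integrable H (volume.prod volume) :=
    (hf.mul_prod hwi).mul_bdd (c := C⁻¹) (Continuous.aestronglyMeasurable (by fun_prop))
      (.of_forall fun p => by
        rw [Real.norm_of_nonneg (hw0 _)]
        refine mul_le_of_le_one_right (by positivity) (exp_le_one_iff.2 ?_)
        have : 0 ≤ a * ‖p.1 + p.2‖ ^ 2 := by positivity
        linarith)
  have hmp := measurePreserving_sub_prod (G := V) volume volume
  have hHeq : ∀ p : V × V, H (p.1 - p.2, p.2) =
      (ENNReal.ofReal (w p.1 * w p.2)).toReal • f (p.1 - p.2) := fun p => by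
    simp only [H, sub_add_cancel, smul_eq_mul,
      ENNReal.toReal_ofReal (mul_nonneg (hw0 p.1) (hw0 p.2))]
    ring
  have hwm2 : Measurable fun p : V × V => ENNReal.ofReal (w p.1 * w p.2) := by fun_prop
  have hF : Integrable (fun p : V × V => f (p.1 - p.2)) (P.prod P) := by
    rw [hPP, integrable_withDensity_iff_integrable_smul' hwm2 (by simp)]
    exact (hmp.integrable_comp_of_integrable hH).congr (.of_forall hHeq)
  have h := integral_prod_nonneg_of_sum_nonneg P hF (by simp) hpos
  have hval : ∫ p : V × V, f (p.1 - p.2) ∂(P.prod P) =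
      ∫ z, f z * (C⁻¹ * C⁻¹ * (∫ x : V, exp (-(2 * a) * ‖x‖ ^ 2)) *
        exp (-(a / 2) * ‖z‖ ^ 2)) := by
    rw [hPP, integral_withDensity_eq_integral_toReal_smul hwm2 (by simp)]
    have h1 := integral_map hmp.measurable.aemeasurable (f := H) (by rw [hmp.map_eq]; exact hH.1)
    rw [hmp.map_eq] at h1
    rw [← integral_congr_ae (.of_forall hHeq), ← h1, integral_prod _ hH]
    refine integral_congr_ae (.of_forall fun z => ?_)
    have h2 : ∀ y, H (z, y) = f z * (C⁻¹ * C⁻¹) * exp (-(a / 2) * ‖z‖ ^ 2) *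
        exp (-(2 * a) * ‖y + (1 / 2 : ℝ) • z‖ ^ 2) := fun y => by
      -- Completing the square in `y` separates the Gaussian in `z` from a translate whose integral
      -- does not depend on `z`.
      have h3 : -(a / 2) * ‖z‖ ^ 2 + -(2 * a) * ‖y + (1 / 2 : ℝ) • z‖ ^ 2 =
          -a * ‖y‖ ^ 2 + -a * ‖z + y‖ ^ 2 := by
        rw [norm_add_sq_real, norm_add_sq_real, inner_smul_right, norm_smul, real_inner_comm]
        norm_num
        ring
      rw [mul_assoc _ (exp _), ← exp_add, h3, exp_add]
      simp only [H, w, g]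
      ring
    simp only [h2]
    rw [integral_const_mul, integral_add_right_eq_self (fun y => exp (-(2 * a) * ‖y‖ ^ 2))]
    ring
  have hC2 : 0 < ∫ x : V, exp (-(2 * a) * ‖x‖ ^ 2) :=
    integral_exp_neg_mul_sq_norm_pos (by positivity)
  rw [hval] at h
  simp only [mul_left_comm (f _)] at h
  rw [integral_const_mul] at h
  exact nonneg_of_mul_nonneg_right h (by positivity)

/-- Let the Gaussian weight tend to 1 as `a` decreases to 0, with `‖f‖` as dominating function. -/
theorem integral_nonneg_of_sum_nonneg {f : V → ℝ} (hf : Integrable f)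
    (hpos : ∀ (N : ℕ) (x : Fin N → V), 0 ≤ ∑ a, ∑ b, f (x a - x b)) : 0 ≤ ∫ z, f z := by
  have h : Tendsto (fun a : ℝ => ∫ z, f z * exp (-(a / 2) * ‖z‖ ^ 2)) (𝓝[>] 0) (𝓝 (∫ z, f z)) := by
    refine tendsto_integral_filter_of_dominated_convergence (fun z => ‖f z‖) ?_ ?_ hf.norm ?_
    · exact .of_forall fun a => hf.1.mul (Continuous.aestronglyMeasurable (by fun_prop))
    · filter_upwards [self_mem_nhdsWithin] with a ha
      refine .of_forall fun z => ?_
      have ha : 0 < a := ha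
      rw [norm_mul, Real.norm_eq_abs (exp _), abs_exp]
      refine mul_le_of_le_one_right (norm_nonneg _) (exp_le_one_iff.2 ?_)
      have : 0 ≤ a / 2 * ‖z‖ ^ 2 := by positivity
      linarith
    · refine .of_forall fun z => tendsto_nhdsWithin_of_tendsto_nhds ?_
      have : Continuous fun a : ℝ => f z * exp (-(a / 2) * ‖z‖ ^ 2) := by fun_prop
      simpa using this.tendsto 0
  refine ge_of_tendsto h ?_
  filter_upwards [self_mem_nhdsWithin] with a ha using integral_mul_gaussian_nonneg hf hpos ha

end Sampling

/-! ### Fourier inversion, pointwise by Gaussian means and almost everywhere. -/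

section Inversion

open Real Filter Topology

variable {V : Type*} [NormedAddCommGroup V] [InnerProductSpace ℝ V] [MeasurableSpace V]
  [BorelSpace V] [FiniteDimensional ℝ V]

/-- Pointwise inversion of the Fourier transform of an integrable function by Gaussian summation. -/
theorem tendsto_integral_gaussian_fourier {f : V → ℂ} (hf : Integrable f) {v : V}
    (hv : ContinuousAt f v) :
    Tendsto (fun c : ℝ => ∫ w : V,
      Complex.exp (-(c : ℂ)⁻¹ * ‖w‖ ^ 2 + 2 * π * Complex.I * (inner ℝ v w : ℝ)) • 𝓕 f w)
      atTop (𝓝 (f v)) := by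
  refine (Real.tendsto_integral_gaussian_smul' hf hv).congr' ?_
  filter_upwards [Ioi_mem_atTop 0] with c (hc : 0 < c)
  have J : Integrable fun w : V =>
      Complex.exp (-(c : ℂ)⁻¹ * ‖w‖ ^ 2 + 2 * π * Complex.I * (inner ℝ v w : ℝ)) :=
    GaussianFourier.integrable_cexp_neg_mul_sq_norm_add (by simpa) _ _
  -- The multiplication formula moves the transform from the Gaussian to `f`.
  have h : ∫ w : V, 𝓕 (fun w : V =>
      Complex.exp (-(c : ℂ)⁻¹ * ‖w‖ ^ 2 + 2 * π * Complex.I * (inner ℝ v w : ℝ))) w • f w =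
      ∫ w : V, Complex.exp (-(c : ℂ)⁻¹ * ‖w‖ ^ 2 + 2 * π * Complex.I * (inner ℝ v w : ℝ)) •
        𝓕 f w := by
    simpa using! VectorFourier.integral_fourierIntegral_smul_eq_flip (L := innerₗ V)
      Real.continuous_fourierChar continuous_inner J hf
  rw [← h]
  refine integral_congr_ae (.of_forall fun w => ?_)
  simp only
  rw [fourier_gaussian_innerProductSpace' (by simpa), div_inv_eq_mul, div_inv_eq_mul,
    mul_right_comm _ _ (c : ℂ)]

theorem integrable_gaussian_smul_fourier {f : V → ℂ} (hf : Integrable f) (v : V) {c : ℝ}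
    (hc : 0 < c) :
    Integrable fun w : V =>
      Complex.exp (-(c : ℂ)⁻¹ * ‖w‖ ^ 2 + 2 * π * Complex.I * (inner ℝ v w : ℝ)) • 𝓕 f w := by
  have J : Integrable fun w : V =>
      Complex.exp (-(c : ℂ)⁻¹ * ‖w‖ ^ 2 + 2 * π * Complex.I * (inner ℝ v w : ℝ)) :=
    GaussianFourier.integrable_cexp_neg_mul_sq_norm_add (by simpa) _ _
  refine J.mul_bdd (c := ∫ x, ‖f x‖) ?_ (.of_forall fun w => ?_)
  · exact (VectorFourier.fourierIntegral_continuous Real.continuous_fourierChar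
      continuous_inner hf).aestronglyMeasurable
  · exact VectorFourier.norm_fourierIntegral_le_integral_norm _ _ _ _ _

theorem re_gaussian_smul (c θ r s : ℝ) :
    (Complex.exp (-(c : ℂ)⁻¹ * r ^ 2 + 2 * π * Complex.I * θ) • (s : ℂ)).re =
      exp (-c⁻¹ * r ^ 2) * cos (2 * π * θ) * s := by
  rw [show -(c : ℂ)⁻¹ * r ^ 2 + 2 * π * Complex.I * θ =
    ((-c⁻¹ * r ^ 2 : ℝ) : ℂ) + ((2 * π * θ : ℝ) : ℂ) * Complex.I by push_cast; ring,
    smul_eq_mul, Complex.re_mul_ofReal, Complex.exp_re, Complex.add_re, Complex.add_im,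
    Complex.ofReal_re, Complex.ofReal_im, Complex.re_ofReal_mul, Complex.im_ofReal_mul,
    Complex.I_re, Complex.I_im, mul_zero, mul_one, add_zero, zero_add]

theorem integrable_gaussian_mul_cosTransform {f : V → ℝ} (hf : Integrable f)
    (heven : ∀ x, f (-x) = f x) (v : V) {c : ℝ} (hc : 0 < c) :
    Integrable fun w : V =>
      exp (-c⁻¹ * ‖w‖ ^ 2) * cos (2 * π * inner ℝ v w) * cosTransform f w := by
  refine (integrable_gaussian_smul_fourier (f := fun x => (f x : ℂ)) hf.ofReal v hc).re.congr
    (.of_forall fun w => ?_)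
  simp only
  rw [fourier_eq_cosTransform hf heven]
  exact re_gaussian_smul _ _ _ _

theorem tendsto_integral_gaussian_cosTransform {f : V → ℝ} (hf : Integrable f)
    (heven : ∀ x, f (-x) = f x) {v : V} (hv : ContinuousAt f v) :
    Tendsto (fun c : ℝ => ∫ w : V,
      exp (-c⁻¹ * ‖w‖ ^ 2) * cos (2 * π * inner ℝ v w) * cosTransform f w)
      atTop (𝓝 (f v)) := by
  have h := (Complex.continuous_re.tendsto _).comp (tendsto_integral_gaussian_fourier
    (f := fun x => (f x : ℂ)) hf.ofReal (Complex.continuous_ofReal.continuousAt.comp hv))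
  refine h.congr' ?_
  filter_upwards [Ioi_mem_atTop 0] with c (hc : 0 < c)
  rw [Function.comp_apply]
  refine (integral_re (integrable_gaussian_smul_fourier (f := fun x => (f x : ℂ)) hf.ofReal v hc)).symm.trans ?_
  refine integral_congr_ae (.of_forall fun w => ?_)
  simp only
  rw [fourier_eq_cosTransform hf heven]
  exact re_gaussian_smul _ _ _ _

theorem continuous_fourierInv {f : V → ℂ} (hf : Integrable f) : Continuous (𝓕⁻ f) := by
  have h : 𝓕⁻ f = fun v => 𝓕 f (-v) := funext fun v => Real.fourierInv_eq_fourier_neg f v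
  rw [h]
  exact (VectorFourier.fourierIntegral_continuous Real.continuous_fourierChar
      continuous_inner hf).comp continuous_neg

theorem integral_fourier_smul_eq {f g : V → ℂ} (hf : Integrable f) (hg : Integrable g) :
    ∫ w, 𝓕 f w • g w = ∫ x, f x • 𝓕 g x := by
  simpa using! VectorFourier.integral_fourierIntegral_smul_eq_flip (L := innerₗ V)
    Real.continuous_fourierChar continuous_inner hf hg

theorem integral_fourierInv_smul_eq {f g : V → ℂ} (hf : Integrable f) (hg : Integrable g) :
    ∫ w, 𝓕⁻ f w • g w = ∫ x, f x • 𝓕⁻ g x := by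
  have h := integral_fourier_smul_eq hf hg.comp_neg
  rw [← integral_neg_eq_self] at h
  simp only [Real.fourierInv_eq_fourier_neg, neg_neg] at h ⊢
  rw [h]
  refine integral_congr_ae (.of_forall fun x => ?_)
  simp only
  rw [← Real.fourierInv_eq_fourier_neg, Real.fourierInv_eq_fourier_comp_neg]

/-- Fourier inversion almost everywhere for an integrable function with integrable transform. -/
theorem fourierInv_fourier_ae_eq {f : V → ℂ} (hf : Integrable f) (hf' : Integrable (𝓕 f)) :
    𝓕⁻ (𝓕 f) =ᵐ[volume] f := by
  have hloc : LocallyIntegrable (fun x => 𝓕⁻ (𝓕 f) x - f x) volume :=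
    (continuous_fourierInv hf').locallyIntegrable.sub hf.locallyIntegrable
  -- Test against smooth compactly supported `g`: such a `g` is the transform of the Schwartz
  -- function `𝓕⁻ g`, so two uses of the multiplication formula give the same integral against `f`
  -- and against `𝓕⁻ (𝓕 f)`.
  have h := ae_eq_zero_of_integral_contDiff_smul_eq_zero hloc fun g hg hgc => by
    let G : SchwartzMap V ℂ := HasCompactSupport.toSchwartzMap (f := fun x => (g x : ℂ))
      (hgc.comp_left (g := fun t : ℝ => (t : ℂ)) Complex.ofReal_zero)
      (Complex.ofRealCLM.contDiff.comp hg)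
    have hF : 𝓕 (𝓕⁻ (G : V → ℂ)) = G := by
      rw [← SchwartzMap.fourierInv_coe, ← SchwartzMap.fourier_coe,
        FourierTransform.fourier_fourierInv_eq]
    have hGi : Integrable (𝓕⁻ (G : V → ℂ)) := by
      rw [← SchwartzMap.fourierInv_coe]
      exact SchwartzMap.integrable _
    have h1 := integral_fourier_smul_eq hGi hf
    have h2 := integral_fourierInv_smul_eq G.integrable hf'
    rw [hF] at h1
    simp only [smul_sub]
    rw [integral_sub]
    · simp only [← Complex.coe_smul]
      exact sub_eq_zero.2 (h2.symm.trans h1.symm)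
    · exact ((continuous_fourierInv hf').locallyIntegrable).integrable_smul_left_of_hasCompactSupport
        hg.continuous hgc
    · exact hf.locallyIntegrable.integrable_smul_left_of_hasCompactSupport hg.continuous hgc
  filter_upwards [h] with x hx using sub_eq_zero.1 hx

end Inversion

/-! ### Positive definiteness and the signs of the coefficients. -/

section PositiveDefinite

open Real Filter Topology

variable {d : ℕ} {k : EuclideanSpace ℝ (Fin d) → Matrix (Fin d) (Fin d) ℝ} {kpar kperp : ℝ → ℝ}

/-- The addition formula makes a cosine factor harmless: it is absorbed into two families of test
vectors. Both directions rely on this. -/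
theorem cos_sub_mul_dotProduct_mulVec (θ η : ℝ) (M : Matrix (Fin d) (Fin d) ℝ) (v w : Fin d → ℝ) :
    cos (θ - η) * (v ⬝ᵥ M.mulVec w) = (cos θ • v) ⬝ᵥ M.mulVec (cos η • w) +
      (sin θ • v) ⬝ᵥ M.mulVec (sin η • w) := by
  rw [cos_sub]
  simp only [Matrix.mulVec_smul, smul_dotProduct, dotProduct_smul, smul_eq_mul]
  ring

theorem single_dotProduct_mulVec_single (M : Matrix (Fin d) (Fin d) ℝ) (i j : Fin d) :
    (Pi.single i (1 : ℝ)) ⬝ᵥ M.mulVec (Pi.single j 1) = M i j := by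
  rw [single_one_dotProduct, Matrix.mulVec_single_one, Matrix.col_apply]

/-- The diagonal entries of the transform of a positive definite function are nonnegative. -/
theorem IsPosDefFunction.cosTransform_nonneg (hpd : IsPosDefFunction fun x y => k (x - y))
    (hk : ∀ i j, Integrable fun x => k x i j) (i : Fin d) (ξ : EuclideanSpace ℝ (Fin d)) :
    0 ≤ cosTransform (fun x => k x i i) ξ := by
  refine integral_nonneg_of_sum_nonneg (integrable_mul_cos (hk i i) ξ) fun N x => ?_
  let θ : Fin N → ℝ := fun a => 2 * π * inner ℝ ξ (x a)
  have h1 := hpd N x fun a => cos (θ a) • Pi.single i 1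
  have h2 := hpd N x fun a => sin (θ a) • Pi.single i 1
  refine (add_nonneg h1 h2).trans_eq ?_
  simp only [← Finset.sum_add_distrib]
  refine Finset.sum_congr rfl fun a _ => Finset.sum_congr rfl fun b _ => ?_
  rw [← cos_sub_mul_dotProduct_mulVec, single_dotProduct_mulVec_single, mul_comm, inner_sub_right,
    mul_sub]

/-- A continuous integrable even matrix function with positive semidefinite transform is positive
definite. -/
theorem isPosDefFunction_of_cosTransform (hd : 0 < d) (hc : Continuous k)
    (hk : ∀ i j, Integrable fun x => k x i j) (heven : ∀ x, k (-x) = k x)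
    (hpos : ∀ ξ ≠ 0, ∀ p : Fin d → ℝ,
      0 ≤ p ⬝ᵥ (Matrix.of fun i j => cosTransform (fun x => k x i j) ξ).mulVec p) :
    IsPosDefFunction fun x y => k (x - y) := by
  intro N x α
  have hsum : ∀ M : Fin N → Fin N → Matrix (Fin d) (Fin d) ℝ,
      ∑ a, ∑ b, α a ⬝ᵥ (M a b).mulVec (α b) =
        ∑ a, ∑ b, ∑ i, ∑ j, α a i * α b j * M a b i j := fun M => by
    simp only [dotProduct, Matrix.mulVec, Finset.mul_sum]
    refine Finset.sum_congr rfl fun a _ => Finset.sum_congr rfl fun b _ =>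
      Finset.sum_congr rfl fun i _ => Finset.sum_congr rfl fun j _ => by ring
  have heven' : ∀ i j x, k (-x) i j = k x i j := fun i j x => by rw [heven]
  have hc' : ∀ i j, Continuous fun x => k x i j := fun i j => hc.matrix_elem i j
  let K : EuclideanSpace ℝ (Fin d) → Matrix (Fin d) (Fin d) ℝ :=
    fun w => Matrix.of fun i j => cosTransform (fun x => k x i j) w
  -- The Gaussian factor makes each integral converge, so the transform itself need not be
  -- integrable.
  have hlim : Tendsto (fun c : ℝ => ∑ a, ∑ b, ∑ i, ∑ j, α a i * α b j *
      ∫ w, exp (-c⁻¹ * ‖w‖ ^ 2) * cos (2 * π * inner ℝ (x a - x b) w) * K w i j) atTop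
      (𝓝 (∑ a, ∑ b, α a ⬝ᵥ (k (x a - x b)).mulVec (α b))) := by
    rw [hsum]
    exact tendsto_finsetSum _ fun a _ => tendsto_finsetSum _ fun b _ =>
      tendsto_finsetSum _ fun i _ => tendsto_finsetSum _ fun j _ =>
        (tendsto_integral_gaussian_cosTransform (hk i j) (heven' i j)
          (hc' i j).continuousAt).const_mul _
  refine ge_of_tendsto hlim ?_
  filter_upwards [Ioi_mem_atTop 0] with c (hc0 : 0 < c)
  have hint : ∀ a b i j, Integrable fun w => α a i * α b j *
      (exp (-c⁻¹ * ‖w‖ ^ 2) * cos (2 * π * inner ℝ (x a - x b) w) * K w i j) := fun a b i j =>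
    (integrable_gaussian_mul_cosTransform (hk i j) (heven' i j) _ hc0).const_mul _
  simp only [← integral_const_mul]
  simp only [← integral_finsetSum _ fun j _ => hint _ _ _ j]
  simp only [← integral_finsetSum _ fun i _ => integrable_finsetSum _ fun j _ => hint _ _ i j]
  simp only [← integral_finsetSum _ fun b _ => integrable_finsetSum _ fun i _ =>
    integrable_finsetSum _ fun j _ => hint _ b i j]
  rw [← integral_finsetSum _ fun a _ => integrable_finsetSum _ fun b _ =>
    integrable_finsetSum _ fun i _ => integrable_finsetSum _ fun j _ => hint a b i j]
  refine integral_nonneg_of_ae ?_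
  filter_upwards [ae_ne_zero hd] with w hw
  -- With one matrix for all pairs, the double sum is the quadratic form at `∑ a, p a`.
  have hquad : ∀ p : Fin N → Fin d → ℝ, 0 ≤ ∑ a, ∑ b, p a ⬝ᵥ (K w).mulVec (p b) := fun p => by
    refine (hpos w hw (∑ a, p a)).trans_eq ?_
    rw [Matrix.mulVec_sum, sum_dotProduct]
    simp only [dotProduct_sum]
    rfl
  let θ : Fin N → ℝ := fun a => 2 * π * inner ℝ (x a) w
  have h := mul_nonneg (exp_nonneg (-c⁻¹ * ‖w‖ ^ 2)) (add_nonneg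
    (hquad fun a => cos (θ a) • α a) (hquad fun a => sin (θ a) • α a))
  refine h.trans_eq ?_
  simp only [← Finset.sum_add_distrib, ← cos_sub_mul_dotProduct_mulVec]
  simp only [Finset.mul_sum, dotProduct, Matrix.mulVec]
  refine Finset.sum_congr rfl fun a _ => Finset.sum_congr rfl fun b _ =>
      Finset.sum_congr rfl fun i _ => Finset.sum_congr rfl fun j _ => ?_
  simp only [θ, inner_sub_left, mul_sub]
  ring

theorem prPar_quadratic_nonneg (x : EuclideanSpace ℝ (Fin d)) (p : Fin d → ℝ) :
    0 ≤ p ⬝ᵥ (prPar x).mulVec p ∧ 0 ≤ p ⬝ᵥ (prPerp x).mulVec p := by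
  have h1 : p ⬝ᵥ (prPar x).mulVec p = (∑ i, x i * p i) ^ 2 / ‖x‖ ^ 2 := by
    rw [sq, Finset.sum_mul_sum]
    simp only [dotProduct, Matrix.mulVec, prPar_apply, Finset.sum_div, Finset.mul_sum]
    exact Finset.sum_congr rfl fun i _ => Finset.sum_congr rfl fun j _ => by ring
  have h2 : (∑ i, x i * p i) ^ 2 ≤ ‖x‖ ^ 2 * ∑ i, p i ^ 2 := by
    rw [EuclideanSpace.real_norm_sq_eq]
    exact Finset.sum_mul_sq_le_sq_mul_sq _ _ _
  refine ⟨by rw [h1]; positivity, ?_⟩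
  rw [prPerp, Matrix.sub_mulVec, Matrix.one_mulVec, dotProduct_sub, h1, sub_nonneg]
  refine div_le_of_le_mul₀ (by positivity) ?_ ?_
  · exact Finset.sum_nonneg fun i _ => mul_self_nonneg _
  · rw [mul_comm]
    simpa only [dotProduct, ← sq] using h2

/-- At a frequency on the first axis, the first diagonal entry of the transform is `hPar` and the
second is `hPerp`; `2 ≤ d` provides the second axis. -/
theorem HasCoefficients.hPar_hPerp_nonneg (hd : 2 ≤ d) (h : HasCoefficients k kpar kperp)
    (hk : ∀ i j, Integrable fun x => k x i j)
    (hpos : ∀ i ξ, 0 ≤ cosTransform (fun x => k x i i) ξ) {ϱ : ℝ} (hϱ : 0 < ϱ) :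
    0 ≤ hPar d kpar kperp ϱ ∧ 0 ≤ hPerp d kpar kperp ϱ := by
  let i₀ : Fin d := ⟨0, by omega⟩
  let i₁ : Fin d := ⟨1, by omega⟩
  have hne : i₁ ≠ i₀ := by simp [i₀, i₁]
  let ξ : EuclideanSpace ℝ (Fin d) := EuclideanSpace.single i₀ ϱ
  have hn : ‖ξ‖ = ϱ := by simp [ξ, abs_of_pos hϱ]
  have hξ : ξ ≠ 0 := by rw [← norm_pos_iff, hn]; exact hϱ
  have h0 := hpos i₀ ξ
  have h1 := hpos i₁ ξ
  rw [h.cosTransform_apply hd hk hξ, hn] at h0 h1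
  have e0 : prPar ξ i₀ i₀ = 1 := by
    rw [prPar_apply, hn]
    simp only [ξ, PiLp.single_apply, if_true]
    field_simp
  have e1 : prPar ξ i₁ i₁ = 0 := by
    rw [prPar_apply]
    simp [ξ, hne]
  simp only [prPerp, Matrix.add_apply, Matrix.smul_apply, Matrix.sub_apply, Matrix.one_apply_eq,
    e0, e1, smul_eq_mul] at h0 h1
  constructor <;> linarith

/-- A continuous version of an integrable matrix function with coefficients is a positive kernel if
and only if the coefficients of the Fourier transform are nonnegative. -/
theorem HasCoefficients.isPositiveKernel_iff (hd : 2 ≤ d) (h : HasCoefficients k kpar kperp)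
    (hk : ∀ i j, Integrable fun x => k x i j)
    {k' : EuclideanSpace ℝ (Fin d) → Matrix (Fin d) (Fin d) ℝ} (hc : Continuous k')
    (hae : k' =ᵐ[volume] k) :
    IsPositiveKernel (fun x y => k' (x - y)) ↔
      ∀ ϱ : ℝ, 0 < ϱ → 0 ≤ hPar d kpar kperp ϱ ∧ 0 ≤ hPerp d kpar kperp ϱ := by
  have hd0 : 0 < d := by omega
  have hae' : ∀ i j, (fun x => k' x i j) =ᵐ[volume] fun x => k x i j := fun i j => by
    filter_upwards [hae] with x hx using by rw [hx]
  have hk' : ∀ i j, Integrable fun x => k' x i j := fun i j => (hk i j).congr (hae' i j).symm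
  have hcos : ∀ i j ξ, cosTransform (fun x => k' x i j) ξ = cosTransform (fun x => k x i j) ξ :=
    fun i j ξ => integral_congr_ae <| by
      filter_upwards [hae' i j] with x hx
      rw [hx]
  constructor
  · rintro ⟨hpd, -⟩ ϱ hϱ
    exact h.hPar_hPerp_nonneg hd hk
      (fun i ξ => (hpd.cosTransform_nonneg hk' i ξ).trans_eq (hcos i i ξ)) hϱ
  · intro hpos
    have haeneg : ∀ᵐ x : EuclideanSpace ℝ (Fin d), k' (-x) = k (-x) :=
      (Measure.measurePreserving_neg volume).quasiMeasurePreserving.ae hae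
    have heven : ∀ x, k' (-x) = k' x := by
      have : (fun x => k' (-x)) = k' := by
        refine Continuous.ae_eq_iff_eq volume (hc.comp continuous_neg) hc |>.1 ?_
        filter_upwards [hae, haeneg] with x hx hx'
        exact hx'.trans ((h.apply_neg x).trans hx.symm)
      exact fun x => congrFun this x
    -- Symmetry holds almost everywhere and extends by continuity, in particular to 0, where the
    -- coefficients say nothing about `k`.
    have hsymm : ∀ x, (k' x).transpose = k' x := by
      have : (fun x => (k' x).transpose) = k' := by
        refine Continuous.ae_eq_iff_eq volume hc.matrix_transpose hc |>.1 ?_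
        filter_upwards [hae, ae_ne_zero hd0] with x hx hx0
        rw [hx]
        ext i j
        exact h.apply_comm hx0 j i
      exact fun x => congrFun this x
    refine ⟨isPosDefFunction_of_cosTransform hd0 hc hk' heven fun ξ hξ p => ?_, fun x y => ?_⟩
    · have hM : (Matrix.of fun i j => cosTransform (fun x => k' x i j) ξ) =
          hPar d kpar kperp ‖ξ‖ • prPar ξ + hPerp d kpar kperp ‖ξ‖ • prPerp ξ := by
        ext i j
        rw [Matrix.of_apply, hcos, h.cosTransform_apply hd hk hξ]
      obtain ⟨h1, h2⟩ := hpos ‖ξ‖ (norm_pos_iff.2 hξ)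
      obtain ⟨h3, h4⟩ := prPar_quadratic_nonneg ξ p
      rw [hM, Matrix.add_mulVec, Matrix.smul_mulVec, Matrix.smul_mulVec, dotProduct_add,
        dotProduct_smul, dotProduct_smul, smul_eq_mul, smul_eq_mul]
      positivity
    · simp only
      rw [hsymm, ← heven, neg_sub]

/-- The inverse transform of an integrable function is continuous; its real part suffices because
`k` is real. -/
theorem exists_continuous_ae_eq (hk : ∀ i j, Integrable fun x => k x i j)
    (hF : ∀ i j, Integrable fun ξ => matrixFourier k ξ i j) :
    ∃ k' : EuclideanSpace ℝ (Fin d) → Matrix (Fin d) (Fin d) ℝ,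
      Continuous k' ∧ k' =ᵐ[volume] k := by
  refine ⟨fun x => Matrix.of fun i j => (𝓕⁻ (fun ξ => matrixFourier k ξ i j) x).re, ?_, ?_⟩
  · refine continuous_matrix fun i j => ?_
    exact Complex.continuous_re.comp (continuous_fourierInv (hF i j))
  · have h : ∀ i j, ∀ᵐ x, 𝓕⁻ (fun ξ => matrixFourier k ξ i j) x = (k x i j : ℂ) := fun i j =>
      fourierInv_fourier_ae_eq (hk i j).ofReal (hF i j)
    filter_upwards [ae_all_iff.2 fun i => ae_all_iff.2 (h i)] with x hx
    ext i j
    rw [Matrix.of_apply, hx, Complex.ofReal_re]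

end PositiveDefinite

theorem theorem3p11 (d : ℕ) (hd : 2 ≤ d)
    (k : EuclideanSpace ℝ (Fin d) → Matrix (Fin d) (Fin d) ℝ) (kpar kperp : ℝ → ℝ)
    (hk : ∀ i j, Integrable (fun x => k x i j)) (hform : HasCoefficients k kpar kperp) :
    -- the integrals in the formulas for the coefficients converge absolutely
    (∀ ϱ : ℝ, 0 < ϱ →
      IntegrableOn (hankelIntegrand d kpar ϱ) (Set.Ioi 0) ∧
      IntegrableOn (hankelIntegrand d kperp ϱ) (Set.Ioi 0) ∧
      IntegrableOn (hankelIntegrandSucc d (fun s => kpar s - kperp s) ϱ) (Set.Ioi 0)) ∧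
    -- the Fourier transform has the same form, with the stated coefficients
    (∀ ξ : EuclideanSpace ℝ (Fin d), ξ ≠ 0 →
      matrixFourier k ξ =
        (hPar d kpar kperp ‖ξ‖ • prPar ξ + hPerp d kpar kperp ‖ξ‖ • prPerp ξ).map
          (fun t : ℝ => (t : ℂ))) ∧
    -- positive definiteness forces nonnegative coefficients
    (IsPosDefFunction (fun x y => k (x - y)) →
      ∀ ϱ : ℝ, 0 < ϱ → 0 ≤ hPar d kpar kperp ϱ ∧ 0 ≤ hPerp d kpar kperp ϱ) ∧
    -- for continuous `k`, being a kernel is equivalent to nonnegativity of the coefficients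
    (Continuous k →
      (IsPositiveKernel (fun x y => k (x - y)) ↔
        ∀ ϱ : ℝ, 0 < ϱ → 0 ≤ hPar d kpar kperp ϱ ∧ 0 ≤ hPerp d kpar kperp ϱ)) ∧
    -- if the Fourier transform is integrable, `k` has a continuous version, to which this applies
    ((∀ i j, Integrable (fun ξ => matrixFourier k ξ i j)) →
      ∃ k' : EuclideanSpace ℝ (Fin d) → Matrix (Fin d) (Fin d) ℝ,
        Continuous k' ∧ k' =ᵐ[volume] k ∧
        (IsPositiveKernel (fun x y => k' (x - y)) ↔
          ∀ ϱ : ℝ, 0 < ϱ → 0 ≤ hPar d kpar kperp ϱ ∧ 0 ≤ hPerp d kpar kperp ϱ)) := by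
  refine ⟨fun ϱ hϱ => ⟨?_, ?_, ?_⟩, fun ξ hξ => hform.matrixFourier_eq hd hk hξ,
    fun hpd ϱ hϱ => hform.hPar_hPerp_nonneg hd hk (hpd.cosTransform_nonneg hk) hϱ,
    fun hc => hform.isPositiveKernel_iff hd hk hc (Filter.EventuallyEq.refl _ _), fun hF => ?_⟩
  · exact integrableOn_hankelIntegrand (by omega) (hform.integrable_par (by omega) hk) hϱ
  · exact integrableOn_hankelIntegrand (by omega) (hform.integrable_perp hd hk) hϱ
  · exact integrableOn_hankelIntegrandSucc (g := fun s => kpar s - kperp s) hd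
      ((hform.integrable_par (by omega) hk).sub (hform.integrable_perp hd hk)) hϱ
  · obtain ⟨k', hc, hae⟩ := exists_continuous_ae_eq hk hF
    exact ⟨k', hc, hae, hform.isPositiveKernel_iff hd hk hc hae⟩
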